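/- Let $0\le q\le d$ be integers and equip $\mathbb R^d$ with the scalar product $xy=-x_1y_1-\cdots-x_qy_q+x_{q+1}y_{q+1}+\cdots+x_dy_d$; write $p^2=pp$. Let $\mu>0$ and $m\ge 0$ be real, with $\mu<d$ if $m=0$. The limits $$\frac{1}{(m^2+p^2\mp\mathrm i0)^{\mu/2}}:=\lim_{\epsilon\searrow0}\frac{1}{(m^2+p^2\mp\mathrm i\epsilon)^{\mu/2}}$$ (principal branch of the power) exist in $\mathcal S'(\mathbb R^d)$. Define the Feynman ($\mathrm F$, upper sign) and anti-Feynman ($\bar{\mathrm F}$, lower sign) Bessel potentials as the tempered distributions $$G^{\mathrm F/\bar{\mathrm F}}_{\mu,m}(x)=\int\frac{e^{\mathrm ipx}}{(m^2+p^2\mp\mathrm i0)^{\mu/2}}\frac{\mathrm dp}{(2\pi)^d}.$$ For $T\in\mathcal D'(\mathbb R^d)$ and $\lambda>0$ let $\langle T_\lambda,f\rangle=\lambda^{-d}\langle T,f(\lambda^{-1}\,\cdot)\rangle$, and let the scaling degree of $T$ be $$\mathrm{sd}(T)=\inf\Big\{\omega\in\mathbb R:\ \lim_{\lambda\searrow0}\lambda^\omega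 T_\lambda=0\ \text{ in }\mathcal D'(\mathbb R^d)\Big\}\in[-\infty,\infty].$$ Then $$\mathrm{sd}\,G^{\mathrm F/\bar{\mathrm F}}_{\mu,m}=\begin{cases}d-\mu,&0<\mu\le d,\\ 0,&\mu\ge d.\end{cases}$$ -/

import Mathlib

open Filter Topology MeasureTheory TopologicalSpace
open scoped Distributions SchwartzMap FourierTransform ContDiff

noncomputable section

namespace BesselPotential

/-! ### Distributions on a finite-dimensional space -/

section Distributions

variable {E : Type*} [NormedAddCommGroup E] [NormedSpace ℝ E]

/-- Dilation of test functions, `φ ↦ φ(l⁻¹ ·)`, as a continuous linear map on test functions. -/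
def testDilation (l : ℝ) (hl : 0 < l) :
    𝓓((⊤ : Opens E), ℝ) →L[ℝ] 𝓓((⊤ : Opens E), ℝ) :=
  TestFunction.limitCLM ℝ
    (fun f ↦ ⟨fun x ↦ f (l⁻¹ • x), f.contDiff.comp (contDiff_const_smul _),
      f.hasCompactSupport.comp_smul (inv_ne_zero hl.ne'), fun _ _ ↦ trivial⟩)
    (fun K _ ↦ TestFunction.ofSupportedInCLM ℝ (K := K.map (fun x ↦ l • x)
        (continuous_const_smul l)) (fun _ _ ↦ trivial) ∘L
      ContDiffMapSupportedIn.mkCLM ℝ (fun f x ↦ f (l⁻¹ • x)) (fun _ _ _ ↦ rfl)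
        (fun _ _ _ ↦ rfl) (fun f ↦ f.contDiff.comp (contDiff_const_smul _))
        (fun f x hx ↦ f.zero_on_compl fun h ↦ hx ⟨l⁻¹ • x, h, by
          simp [smul_smul, mul_inv_cancel₀ hl.ne']⟩)
        (fun i _ ↦ ⟨{i}, |l⁻¹| ^ i, by positivity, fun f x _ ↦ by
          have hf : ContDiff ℝ i f := f.contDiff.of_le (mod_cast le_top)
          rw [iteratedFDeriv_comp_const_smul _ hf]
          simp only [norm_smul, norm_pow, Real.norm_eq_abs, Finset.sup_singleton]
          gcongr
          exact ContDiffMapSupportedIn.norm_iteratedFDeriv_apply_le_seminorm_top ℝ⟩))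
    (fun _ _ _ ↦ rfl)

@[simp]
theorem testDilation_apply (l : ℝ) (hl : 0 < l) (φ : 𝓓((⊤ : Opens E), ℝ)) (x : E) :
    testDilation l hl φ x = φ (l⁻¹ • x) := rfl

/-- The dilated distribution `T_l(x) = T(l x)`, `l > 0`, given by
`⟨T_l, φ⟩ = l ^ (-d) ⟨T, φ(l⁻¹ ·)⟩` with `d = dim E` (and by the junk value `0` if `l ≤ 0`). -/
def dilation (T : 𝓓'((⊤ : Opens E), ℂ)) (l : ℝ) : 𝓓'((⊤ : Opens E), ℂ) :=
  if hl : 0 < l then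
    ((l ^ Module.finrank ℝ E)⁻¹ : ℝ) • (testDilation l hl).precompCompactConvergenceCLM ℂ T
  else 0

theorem dilation_apply (T : 𝓓'((⊤ : Opens E), ℂ)) {l : ℝ} (hl : 0 < l)
    (φ : 𝓓((⊤ : Opens E), ℝ)) :
    dilation T l φ = ((l ^ Module.finrank ℝ E)⁻¹ : ℝ) • T (testDilation l hl φ) := by
  rw [dilation, dif_pos hl]; rfl

/-- The scaling degree `inf {a ∈ ℝ | l ^ a T_l → 0 in 𝓓' as l ↘ 0}`, an extended real number.
Convergence in `𝓓'` is tested on each test function. -/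
def scalingDegree (T : 𝓓'((⊤ : Opens E), ℂ)) : EReal :=
  sInf ((fun a : ℝ ↦ (a : EReal)) ''
    {a : ℝ | ∀ φ : 𝓓((⊤ : Opens E), ℝ),
      Tendsto (fun l : ℝ ↦ (l ^ a • dilation T l) φ) (𝓝[>] 0) (𝓝 0)})

/-- The inclusion of (real) test functions into (complex) Schwartz functions. -/
def testToSchwartz : 𝓓((⊤ : Opens E), ℝ) →L[ℝ] 𝓢(E, ℂ) :=
  TestFunction.mkCLM ℝ
    (fun f ↦ (f.hasCompactSupport.comp_left (g := ((↑) : ℝ → ℂ))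
      Complex.ofReal_zero).toSchwartzMap (Complex.ofRealCLM.contDiff.comp f.contDiff))
    (fun f g ↦ by ext x; exact Complex.ofReal_add (f x) (g x))
    (fun c f ↦ by
      ext x
      change ((c * f x : ℝ) : ℂ) = c • (f x : ℂ)
      simp)
    (fun K _ ↦ by
      let Φ : 𝓓_{K}(E, ℝ) →ₗ[ℝ] 𝓢(E, ℂ) :=
        { toFun := fun f ↦ (f.hasCompactSupport.comp_left (g := ((↑) : ℝ → ℂ))
            Complex.ofReal_zero).toSchwartzMap (Complex.ofRealCLM.contDiff.comp f.contDiff)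
          map_add' := fun f g ↦ by ext x; exact Complex.ofReal_add (f x) (g x)
          map_smul' := fun c f ↦ by
            ext x
            change ((c * f x : ℝ) : ℂ) = c • (f x : ℂ)
            simp }
      change Continuous Φ
      refine WithSeminorms.continuous_of_isBounded
        (ContDiffMapSupportedIn.withSeminorms ℝ E ℝ ⊤ K) (schwartz_withSeminorms ℝ E ℂ) _ ?_
      rintro ⟨k, n⟩
      obtain ⟨R, hR⟩ := K.isCompact.isBounded.exists_norm_le
      refine ⟨{n}, ⟨(max R 0) ^ k, by positivity⟩, fun f ↦ ?_⟩
      refine SchwartzMap.seminorm_le_bound ℝ k n (Φ f) (apply_nonneg _ _) fun x ↦ ?_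
      have hn : ‖iteratedFDeriv ℝ n (Φ f) x‖ = ‖iteratedFDeriv ℝ n f x‖ :=
        Complex.ofRealLI.norm_iteratedFDeriv_comp_left
          (f.contDiff.of_le (mod_cast le_top)).contDiffAt le_rfl
      rw [hn]
      by_cases hx : x ∈ K
      · simp only [Finset.sup_singleton]
        exact mul_le_mul (pow_le_pow_left₀ (norm_nonneg x) ((hR x hx).trans (le_max_left R 0)) k)
          (ContDiffMapSupportedIn.norm_iteratedFDeriv_apply_le_seminorm_top ℝ)
          (norm_nonneg _) (pow_nonneg (le_max_right R 0) k)
      · rw [f.iteratedFDeriv_zero_on_compl hx]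
        simp only [Pi.zero_apply, norm_zero, mul_zero]
        exact apply_nonneg _ _)

@[simp]
theorem testToSchwartz_apply (φ : 𝓓((⊤ : Opens E), ℝ)) (x : E) :
    testToSchwartz φ x = (φ x : ℂ) := rfl

/-- A tempered distribution, regarded as a distribution. -/
def toDistribution (T : 𝓢'(E, ℂ)) : 𝓓'((⊤ : Opens E), ℂ) where
  toFun φ := T (testToSchwartz φ)
  map_add' φ ψ := by simp
  map_smul' c φ := by
    have h : testToSchwartz (c • φ) = (c : ℂ) • testToSchwartz φ := by
      ext x; simp
    rw [h, map_smul]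
    simp
  cont := T.continuous.comp testToSchwartz.continuous

end Distributions

/-! ### Pseudo-Euclidean space -/

variable {d : ℕ}

/-- The sign of the `i`-th square in the scalar product of signature `(q, d - q)`. -/
def metricSign (q : ℕ) (i : Fin d) : ℝ := if (i : ℕ) < q then -1 else 1

theorem metricSign_mul_self (q : ℕ) (i : Fin d) : metricSign q i * metricSign q i = 1 := by
  unfold metricSign; split_ifs <;> norm_num

/-- The scalar product `-x₁y₁ - ⋯ - x_q y_q + x_{q+1} y_{q+1} + ⋯ + x_d y_d`. -/
def pseudoInner (q : ℕ) (x y : EuclideanSpace ℝ (Fin d)) : ℝ :=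
  ∑ i, metricSign q i * (x i * y i)

/-- The linear change of variables `p ↦ -(η p) / (2π)`, `η` being the diagonal matrix of the
scalar product of signature `(q, d - q)`. -/
def momentumEquiv (d q : ℕ) : EuclideanSpace ℝ (Fin d) ≃L[ℝ] EuclideanSpace ℝ (Fin d) :=
  LinearEquiv.toContinuousLinearEquiv
    { toFun := fun p ↦ WithLp.toLp 2 fun i ↦ -(2 * Real.pi)⁻¹ * (metricSign q i * p i)
      invFun := fun p ↦ WithLp.toLp 2 fun i ↦ -(2 * Real.pi) * (metricSign q i * p i)
      map_add' := fun x y ↦ by ext i; simp; ring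
      map_smul' := fun c x ↦ by ext i; simp; ring
      left_inv := fun x ↦ by
        ext i
        have h := metricSign_mul_self q i
        have hpi := Real.pi_ne_zero
        simp only
        field_simp
        linear_combination (x i) * h
      right_inv := fun x ↦ by
        ext i
        have h := metricSign_mul_self q i
        have hpi := Real.pi_ne_zero
        simp only
        field_simp
        linear_combination (x i) * h }

/-- The operator `f ↦ ∫ e^{i p x} f(x) dx / (2π)^d` on Schwartz functions, where `p x` is the
scalar product of signature `(q, d - q)`; see `testFourier_apply`. -/
def testFourier (d q : ℕ) :
    𝓢(EuclideanSpace ℝ (Fin d), ℂ) →L[ℂ] 𝓢(EuclideanSpace ℝ (Fin d), ℂ) :=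
  ((((2 * Real.pi) ^ d)⁻¹ : ℝ) : ℂ) •
    (SchwartzMap.compCLMOfContinuousLinearEquiv ℂ (momentumEquiv d q) ∘L
      FourierTransform.fourierCLM ℂ 𝓢(EuclideanSpace ℝ (Fin d), ℂ))

theorem testFourier_apply (q : ℕ) (f : 𝓢(EuclideanSpace ℝ (Fin d), ℂ))
    (p : EuclideanSpace ℝ (Fin d)) :
    testFourier d q f p = ((((2 * Real.pi) ^ d)⁻¹ : ℝ) : ℂ) *
      ∫ x, Complex.exp (Complex.I * (pseudoInner q p x : ℂ)) * f x := by
  change ((((2 * Real.pi) ^ d)⁻¹ : ℝ) : ℂ) * (𝓕 (f : EuclideanSpace ℝ (Fin d) → ℂ))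
    (momentumEquiv d q p) = _
  rw [Real.fourier_eq']
  congr 1
  refine integral_congr_ae (.of_forall fun x ↦ ?_)
  have h : -2 * Real.pi * inner ℝ x (momentumEquiv d q p) = pseudoInner q p x := by
    have hpi := Real.pi_ne_zero
    simp only [PiLp.inner_apply, pseudoInner, Finset.mul_sum]
    refine Finset.sum_congr rfl fun i _ ↦ ?_
    change -2 * Real.pi * ((-(2 * Real.pi)⁻¹ * (metricSign q i * p i)) * x i) = _
    field_simp
  simp only [smul_eq_mul, h]
  rw [mul_comm Complex.I]

/-- The (inverse) Fourier transform `g ↦ ∫ e^{i p x} g(p) dp / (2π)^d` of tempered distributions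
on the pseudo-Euclidean space, by duality. -/
def pseudoFourierInv (q : ℕ) (T : 𝓢'(EuclideanSpace ℝ (Fin d), ℂ)) :
    𝓢'(EuclideanSpace ℝ (Fin d), ℂ) :=
  PointwiseConvergenceCLM.precomp ℂ (testFourier d q) T

theorem pseudoFourierInv_apply (q : ℕ) (T : 𝓢'(EuclideanSpace ℝ (Fin d), ℂ))
    (f : 𝓢(EuclideanSpace ℝ (Fin d), ℂ)) :
    pseudoFourierInv q T f = T (testFourier d q f) := rfl

/-! ### Bessel potentials -/

/-- The function `p ↦ 1 / (m² + p² + i s) ^ (μ/2)` (principal branch of the power), `s ≠ 0`. -/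
def symbol (q : ℕ) (μ m s : ℝ) (p : EuclideanSpace ℝ (Fin d)) : ℂ :=
  1 / (((m ^ 2 + pseudoInner q p p : ℝ) : ℂ) + Complex.I * (s : ℂ)) ^ ((μ / 2 : ℝ) : ℂ)

theorem memLp_symbol (q : ℕ) {μ : ℝ} (hμ : 0 < μ) (m : ℝ) {s : ℝ} (hs : s ≠ 0) :
    MemLp (symbol (d := d) q μ m s) ⊤ := by
  have hcont : Continuous (pseudoInner q : EuclideanSpace ℝ (Fin d) → _ → ℝ).uncurry := by
    unfold pseudoInner Function.uncurry
    fun_prop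
  have hc2 : Continuous fun p : EuclideanSpace ℝ (Fin d) ↦ pseudoInner q p p :=
    hcont.comp (continuous_id.prodMk continuous_id)
  refine memLp_top_of_bound (C := (|s| ^ (μ / 2))⁻¹) ?_ (.of_forall fun p ↦ ?_)
  · refine Measurable.aestronglyMeasurable ?_
    unfold symbol
    have := hc2.measurable
    fun_prop
  · have him : |s| ≤ ‖((m ^ 2 + pseudoInner q p p : ℝ) : ℂ) + Complex.I * (s : ℂ)‖ := by
      refine le_trans (le_of_eq ?_) (Complex.abs_im_le_norm _)
      rw [Complex.add_im, Complex.ofReal_im]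
      simp
    have hs' : 0 < |s| := abs_pos.mpr hs
    rw [symbol, norm_div, norm_one, Complex.norm_cpow_real, one_div]
    gcongr

open scoped Classical in
/-- The tempered distribution given by a bounded measurable function
(with junk value `0` for other functions). -/
def ofBounded (g : EuclideanSpace ℝ (Fin d) → ℂ) : 𝓢'(EuclideanSpace ℝ (Fin d), ℂ) :=
  if hg : MemLp g ⊤ then Lp.toTemperedDistribution (hg.toLp g) else 0

theorem ofBounded_apply {g : EuclideanSpace ℝ (Fin d) → ℂ} (hg : MemLp g ⊤)
    (f : 𝓢(EuclideanSpace ℝ (Fin d), ℂ)) : ofBounded g f = ∫ p, f p * g p := by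
  rw [ofBounded, dif_pos hg, Lp.toTemperedDistribution_apply]
  refine integral_congr_ae ?_
  filter_upwards [hg.coeFn_toLp] with p hp
  rw [hp, smul_eq_mul]

/-- The boundary value `1 / (m² + p² + i σ 0) ^ (μ/2)`, i.e. the limit in `𝓢'` of
`1 / (m² + p² + i σ ε) ^ (μ/2)` as `ε ↘ 0`. -/
def boundaryValue (d q : ℕ) (σ μ m : ℝ) : 𝓢'(EuclideanSpace ℝ (Fin d), ℂ) :=
  limUnder (𝓝[>] 0) fun ε : ℝ ↦ ofBounded (symbol q μ m (σ * ε))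

/-- The Feynman Bessel potential `∫ e^{i p x} (m² + p² - i0) ^ (-μ/2) dp / (2π)^d`. -/
def feynman (d q : ℕ) (μ m : ℝ) : 𝓢'(EuclideanSpace ℝ (Fin d), ℂ) :=
  pseudoFourierInv q (boundaryValue d q (-1) μ m)

/-- The anti-Feynman Bessel potential `∫ e^{i p x} (m² + p² + i0) ^ (-μ/2) dp / (2π)^d`. -/
def antiFeynman (d q : ℕ) (μ m : ℝ) : 𝓢'(EuclideanSpace ℝ (Fin d), ℂ) :=
  pseudoFourierInv q (boundaryValue d q 1 μ m)

end BesselPotential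

end

open BesselPotential

namespace BesselPotential

/-! ### Laplace integrals up to the imaginary axis -/

/-! Put s = μ/2 and y = τm², with τ = 1 for the Feynman and τ = -1 for the anti-Feynman case.
Multiplication by iτ carries m² + p² - iτε to ε + iτ(m² + p²), which has positive real part, so its
power -s is a Gamma integral of t^(s-1) exp(-t(ε + iτ(m² + p²))). The Fourier transform of
exp(-iτtp²) is a constant times t^(-d/2) exp(iτx²/(4t)). By Fubini
(`integral_testFourier_mul_symbol`) the regularized potential, tested on f, is a nonzero constant
times I_s(f) = ∫ t^(s-1-d/2) O_t(f) exp(-(ε + iy)t) dt over (0, ∞), where O_t(f) = ∫ f(x)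
exp(iτx²/(4t)) dx. Since O_t(f) is bounded and is O(t^(d/2)) as t → 0, there is never a difficulty
at t = 0; at ε = 0 the difficulty is at infinity.

If s < d/2, the integral converges absolutely at ε = 0. The substitution t ↦ l²t turns a dilation of
f into the factor l^(2s-d) and replaces y by l²y (`integral_schwinger_dilate`). Hence l^(d-μ) times
the dilated potential tends to the massless one, which is not zero because away from the light cone
it is a power of x² up to constants (`exists_integral_schwinger_ne_zero`). The degree is d - μ.

If s ≥ d/2, then m ≠ 0 and y ≠ 0. With E_s = s + ½ x·∇, the t-derivative of the integrand of index
s+1 at f is the integrand of index s at E_s f (`hasDerivAt_schwinger`). Integrating by parts on (1,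
∞) only gives the boundary value for s ≤ d/2 + 1; integrating by parts on (0, ∞) gives I_(s+1)(f) =
I_s(E_s f)/(ε + iy) and reaches all larger s by induction (`exists_schwinger_limit`). For s > d/2
the dilated potential converges to a nonzero constant, so the degree is 0. For s = d/2 it grows at
most like l^(-2θ) for every small θ > 0, and on test functions E_s φ it has a limit that can be
nonzero, so the degree is again 0.

All bounds are by the continuous functional `size`, which also shows that the limits are tempered
distributions. -/

theorem norm_cexp_neg_mul_le_one {z : ℂ} (hz : 0 ≤ z.re) {t : ℝ} (ht : 0 ≤ t) :
    ‖Complex.exp (-(z * t))‖ ≤ 1 := by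
  rw [Complex.norm_exp, Real.exp_le_one_iff]
  simp only [Complex.neg_re, Complex.re_mul_ofReal]
  nlinarith [mul_nonneg hz ht]

theorem hasDerivAt_cexp_neg_mul (z : ℂ) (t : ℝ) :
    HasDerivAt (fun t : ℝ ↦ Complex.exp (-(z * t))) (-z * Complex.exp (-(z * t))) t := by
  have h1 : HasDerivAt (fun t : ℝ ↦ (t : ℂ)) 1 t := Complex.ofRealCLM.hasDerivAt
  have h : HasDerivAt (fun t : ℝ ↦ Complex.exp (-(z * t))) _ t := (h1.const_mul z).fun_neg.cexp
  convert h using 1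
  ring

theorem integrableOn_cexp_neg_mul {z : ℂ} (hz : 0 < z.re) (a : ℝ) :
    IntegrableOn (fun t : ℝ ↦ Complex.exp (-(z * t))) (Set.Ioi a) := by
  have h := (integrableOn_exp_mul_complex_Ioi (a := -z) (by simpa using hz) a)
  simpa only [neg_mul] using h

/-- Integration by parts. Since Re z > 0, polynomial growth of v suffices to kill the boundary term
at infinity. At a only a one-sided limit is asked for, so that a = 0 is allowed, where v need not be
differentiable. -/
theorem integral_Ioi_mul_cexp_eq_div {v w : ℝ → ℂ} {z v₀ : ℂ} {C a r : ℝ}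
    (hz : 0 < z.re) (hv : ∀ t ∈ Set.Ioi a, HasDerivAt v (w t) t)
    (hC : ∀ t ∈ Set.Ioi (max a 1), ‖v t‖ ≤ C * t ^ r)
    (hvi : IntegrableOn (fun t ↦ v t * Complex.exp (-(z * t))) (Set.Ioi a))
    (hwi : IntegrableOn (fun t ↦ w t * Complex.exp (-(z * t))) (Set.Ioi a))
    (h0 : Tendsto v (𝓝[>] a) (𝓝 v₀)) :
    ∫ t in Set.Ioi a, v t * Complex.exp (-(z * t)) =
      (v₀ * Complex.exp (-(z * a)) + ∫ t in Set.Ioi a, w t * Complex.exp (-(z * t))) / z := by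
  have hz0 : z ≠ 0 := by rintro rfl; simp at hz
  have hcont : ContinuousAt (fun t : ℝ ↦ Complex.exp (-(z * t))) a :=
    (hasDerivAt_cexp_neg_mul z a).continuousAt
  have h := integral_Ioi_mul_deriv_eq_deriv_mul (u := v) (u' := w)
    (v := fun t : ℝ ↦ Complex.exp (-(z * t))) (v' := fun t ↦ -z * Complex.exp (-(z * t)))
    (a' := v₀ * Complex.exp (-(z * a))) (b' := 0) hv
    (fun t _ ↦ hasDerivAt_cexp_neg_mul z t)
    (by
      have := hvi.const_mul (-z)
      refine this.congr (.of_forall fun t ↦ ?_)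
      simp only [Pi.mul_apply]; ring)
    hwi (h0.mul (hcont.tendsto.mono_left nhdsWithin_le_nhds))
    (by
      refine squeeze_zero_norm' (a := fun t : ℝ ↦ C * (t ^ r * Real.exp (-z.re * t))) ?_ ?_
      · filter_upwards [Ioi_mem_atTop (max a 1)] with t ht
        rw [Pi.mul_apply, norm_mul, Complex.norm_exp, ← mul_assoc, Complex.neg_re,
          Complex.re_mul_ofReal, neg_mul]
        exact mul_le_mul_of_nonneg_right (hC t ht) (Real.exp_pos _).le
      · simpa using (tendsto_rpow_mul_exp_neg_mul_atTop_nhds_zero r z.re hz).const_mul C)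
  have h2 : ∫ t in Set.Ioi a, v t * (-z * Complex.exp (-(z * t))) =
      -z * ∫ t in Set.Ioi a, v t * Complex.exp (-(z * t)) := by
    rw [← integral_const_mul]
    congr 1; ext t; ring
  rw [h2] at h
  rw [eq_div_iff hz0]
  linear_combination -h

/-- The Laplace transform of `v`, rewritten by an integration by parts on `(1, ∞)`; here `w` is the
derivative of `v`. -/
noncomputable def laplaceReg (v w : ℝ → ℂ) (z : ℂ) : ℂ :=
  (∫ t in Set.Ioc 0 1, v t * Complex.exp (-(z * t))) +
    (v 1 * Complex.exp (-z) + ∫ t in Set.Ioi 1, w t * Complex.exp (-(z * t))) / z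

theorem integrableOn_mul_cexp {v : ℝ → ℂ} {z : ℂ} (hz : 0 ≤ z.re) {S : Set ℝ}
    (hS : MeasurableSet S) (hS0 : S ⊆ Set.Ioi 0) (hv : IntegrableOn v S) :
    IntegrableOn (fun t ↦ v t * Complex.exp (-(z * t))) S := by
  refine Integrable.mono hv (hv.aestronglyMeasurable.mul (by fun_prop)) ?_
  filter_upwards [ae_restrict_mem hS] with t ht
  rw [norm_mul]
  exact mul_le_of_le_one_right (norm_nonneg _) (norm_cexp_neg_mul_le_one hz (hS0 ht).le)

/-- The gain is that `laplaceReg` still makes sense for Re z = 0, z ≠ 0: there only w, and not v,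
has to be integrable at infinity. -/
theorem integral_mul_cexp_eq_laplaceReg {v w : ℝ → ℂ} {z : ℂ} {C : ℝ} (hz : 0 < z.re)
    (hv : ∀ t ∈ Set.Ioi 0, HasDerivAt v (w t) t)
    (hC : ∀ t ∈ Set.Ioi 1, ‖v t‖ ≤ C)
    (hvi : IntegrableOn v (Set.Ioc 0 1)) (hwi : IntegrableOn w (Set.Ioi 1)) :
    ∫ t in Set.Ioi 0, v t * Complex.exp (-(z * t)) = laplaceReg v w z := by
  have hsub : Set.Ioi (1 : ℝ) ⊆ Set.Ioi 0 := Set.Ioi_subset_Ioi zero_le_one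
  have hvm : AEStronglyMeasurable v (volume.restrict (Set.Ioi 1)) := by
    refine ContinuousOn.aestronglyMeasurable (fun t ht ↦ ?_) measurableSet_Ioi
    exact (hv t (hsub ht)).continuousAt.continuousWithinAt
  have hvi2 : IntegrableOn (fun t ↦ v t * Complex.exp (-(z * t))) (Set.Ioi 1) := by
    refine Integrable.mono ((integrableOn_cexp_neg_mul hz 1).norm.const_mul C)
      (hvm.mul (by fun_prop)) ?_
    filter_upwards [ae_restrict_mem measurableSet_Ioi] with t ht
    have hC0 : 0 ≤ C := (norm_nonneg _).trans (hC t ht)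
    rw [norm_mul, norm_mul, norm_norm, Real.norm_of_nonneg hC0]
    exact mul_le_mul_of_nonneg_right (hC t ht) (norm_nonneg _)
  have h1 := integral_Ioi_mul_cexp_eq_div hz (fun t ht ↦ hv t (hsub ht))
    (C := C) (r := 0) (by simpa using hC) hvi2
    (integrableOn_mul_cexp hz.le measurableSet_Ioi hsub hwi)
    ((hv 1 (by simp)).continuousAt.tendsto.mono_left nhdsWithin_le_nhds)
  rw [← Set.Ioc_union_Ioi_eq_Ioi zero_le_one, setIntegral_union (Set.Ioc_disjoint_Ioi le_rfl)
    measurableSet_Ioi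
    (integrableOn_mul_cexp hz.le measurableSet_Ioc Set.Ioc_subset_Ioi_self hvi) hvi2, h1,
    laplaceReg]
  simp

theorem norm_integral_mul_cexp_le {v : ℝ → ℂ} {b : ℝ → ℝ} {z : ℂ} (hz : 0 ≤ z.re) {S : Set ℝ}
    (hS : MeasurableSet S) (hS0 : S ⊆ Set.Ioi 0) (hb : ∀ t ∈ S, ‖v t‖ ≤ b t)
    (hbi : IntegrableOn b S) :
    ‖∫ t in S, v t * Complex.exp (-(z * t))‖ ≤ ∫ t in S, b t := by
  refine norm_integral_le_of_norm_le hbi ?_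
  filter_upwards [ae_restrict_mem hS] with t ht
  rw [norm_mul]
  exact (mul_le_of_le_one_right (norm_nonneg _)
    (norm_cexp_neg_mul_le_one hz (hS0 ht).le)).trans (hb t ht)

theorem norm_laplaceReg_le {v w : ℝ → ℂ} {b b' : ℝ → ℝ} {c : ℝ} {z : ℂ} (hz : 0 ≤ z.re)
    (hv : ∀ t ∈ Set.Ioc 0 1, ‖v t‖ ≤ b t) (hvi : IntegrableOn b (Set.Ioc 0 1))
    (hc : ‖v 1‖ ≤ c)
    (hw : ∀ t ∈ Set.Ioi 1, ‖w t‖ ≤ b' t) (hwi : IntegrableOn b' (Set.Ioi 1)) :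
    ‖laplaceReg v w z‖ ≤ (∫ t in Set.Ioc 0 1, b t) + (c + ∫ t in Set.Ioi 1, b' t) / ‖z‖ := by
  have hsub : Set.Ioi (1 : ℝ) ⊆ Set.Ioi 0 := Set.Ioi_subset_Ioi zero_le_one
  refine (norm_add_le _ _).trans (add_le_add
    (norm_integral_mul_cexp_le hz measurableSet_Ioc Set.Ioc_subset_Ioi_self hv hvi) ?_)
  rw [norm_div]
  gcongr
  refine (norm_add_le _ _).trans (add_le_add ?_
    (norm_integral_mul_cexp_le hz measurableSet_Ioi hsub hw hwi))
  rw [norm_mul]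
  have := norm_cexp_neg_mul_le_one hz zero_le_one
  simp only [Complex.ofReal_one, mul_one] at this
  exact (mul_le_of_le_one_right (norm_nonneg _) this).trans hc

theorem tendsto_integral_mul_cexp {ι : Type*} {l : Filter ι} [l.IsCountablyGenerated]
    {v : ι → ℝ → ℂ} {v₀ : ℝ → ℂ} {b : ℝ → ℝ} {z : ι → ℂ} {z₀ : ℂ} {S : Set ℝ}
    (hS : MeasurableSet S) (hS0 : S ⊆ Set.Ioi 0) (hz : ∀ᶠ i in l, 0 ≤ (z i).re)
    (hzt : Tendsto z l (𝓝 z₀))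
    (hm : ∀ᶠ i in l, ContinuousOn (v i) S)
    (hb : ∀ᶠ i in l, ∀ t ∈ S, ‖v i t‖ ≤ b t) (hbi : IntegrableOn b S)
    (hv : ∀ t ∈ S, Tendsto (fun i ↦ v i t) l (𝓝 (v₀ t))) :
    Tendsto (fun i ↦ ∫ t in S, v i t * Complex.exp (-(z i * t))) l
      (𝓝 (∫ t in S, v₀ t * Complex.exp (-(z₀ * t)))) := by
  refine tendsto_integral_filter_of_dominated_convergence b ?_ ?_ hbi ?_
  · filter_upwards [hm] with i hi
    exact (hi.aestronglyMeasurable hS).mul (by fun_prop)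
  · filter_upwards [hz, hb] with i hi hbi
    filter_upwards [ae_restrict_mem hS] with t ht
    rw [norm_mul]
    exact (mul_le_of_le_one_right (norm_nonneg _)
      (norm_cexp_neg_mul_le_one hi (hS0 ht).le)).trans (hbi t ht)
  · filter_upwards [ae_restrict_mem hS] with t ht
    exact (hv t ht).mul ((Complex.continuous_exp.tendsto _).comp (hzt.mul_const _).neg)

/-- Dominated convergence in each of the two integrals. Both the functions and the rate may vary:
the rate moves when the imaginary axis is approached, the functions move when f is dilated. -/
theorem tendsto_laplaceReg {ι : Type*} {l : Filter ι} [l.IsCountablyGenerated]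
    {v w : ι → ℝ → ℂ} {v₀ w₀ : ℝ → ℂ} {b b' : ℝ → ℝ} {z : ι → ℂ} {z₀ : ℂ}
    (hz : ∀ᶠ i in l, 0 ≤ (z i).re) (hzt : Tendsto z l (𝓝 z₀)) (hz0 : z₀ ≠ 0)
    (hvm : ∀ᶠ i in l, ContinuousOn (v i) (Set.Ioi 0))
    (hwm : ∀ᶠ i in l, ContinuousOn (w i) (Set.Ioi 0))
    (hvb : ∀ᶠ i in l, ∀ t ∈ Set.Ioc 0 1, ‖v i t‖ ≤ b t) (hbi : IntegrableOn b (Set.Ioc 0 1))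
    (hwb : ∀ᶠ i in l, ∀ t ∈ Set.Ioi 1, ‖w i t‖ ≤ b' t) (hbi' : IntegrableOn b' (Set.Ioi 1))
    (hv : ∀ t ∈ Set.Ioi 0, Tendsto (fun i ↦ v i t) l (𝓝 (v₀ t)))
    (hw : ∀ t ∈ Set.Ioi 0, Tendsto (fun i ↦ w i t) l (𝓝 (w₀ t))) :
    Tendsto (fun i ↦ laplaceReg (v i) (w i) (z i)) l (𝓝 (laplaceReg v₀ w₀ z₀)) := by
  have hsub : Set.Ioi (1 : ℝ) ⊆ Set.Ioi 0 := Set.Ioi_subset_Ioi zero_le_one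
  refine (tendsto_integral_mul_cexp measurableSet_Ioc Set.Ioc_subset_Ioi_self hz hzt
    (hvm.mono fun i hi ↦ hi.mono Set.Ioc_subset_Ioi_self) hvb hbi fun t ht ↦ hv t ht.1).add
    (((hv 1 (by simp)).mul ((Complex.continuous_exp.tendsto _).comp hzt.neg)).add
      (tendsto_integral_mul_cexp measurableSet_Ioi hsub hz hzt
        (hwm.mono fun i hi ↦ hi.mono hsub) hwb hbi' fun t ht ↦ hw t (hsub ht)) |>.div hzt hz0)

theorem laplaceReg_const_mul (c : ℂ) (v w : ℝ → ℂ) (z : ℂ) :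
    laplaceReg (fun t ↦ c * v t) (fun t ↦ c * w t) z = c * laplaceReg v w z := by
  simp only [laplaceReg, mul_assoc, integral_const_mul]
  ring

/-- The integral defining the Gamma function, with a complex rate. -/
theorem integral_rpow_mul_cexp_neg_mul {s : ℝ} (hs : 0 < s) {z : ℂ} (hz : 0 < z.re) :
    ∫ t in Set.Ioi (0 : ℝ), ((t ^ (s - 1) : ℝ) : ℂ) * Complex.exp (-(z * t)) =
      Complex.Gamma s * z ^ (-s : ℂ) := by
  have hopen : IsOpen {z : ℂ | 0 < z.re} := isOpen_lt continuous_const Complex.continuous_re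
  have hmeas : ∀ r : ℝ, AEStronglyMeasurable (fun t : ℝ ↦ ((t ^ r : ℝ) : ℂ))
      (volume.restrict (Set.Ioi 0)) := fun r ↦ by
    refine Measurable.aestronglyMeasurable ?_
    fun_prop
  have hint : ∀ r : ℝ, -1 < r → ∀ c : ℝ, 0 < c →
      IntegrableOn (fun t : ℝ ↦ t ^ r * Real.exp (-c * t)) (Set.Ioi 0) := fun r hr c hc ↦ by
    simpa using integrableOn_rpow_mul_exp_neg_mul_rpow hr one_pos hc
  -- Both sides are holomorphic on Re z > 0 and agree for real z > 0, so the identity theorem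
  -- applies.
  have hdiff : DifferentiableOn ℂ (fun z : ℂ ↦
      ∫ t in Set.Ioi (0 : ℝ), ((t ^ (s - 1) : ℝ) : ℂ) * Complex.exp (-(z * t)))
      {z : ℂ | 0 < z.re} := by
    intro z hz
    have hz' : 0 < z.re := hz
    have hnb : {w : ℂ | z.re / 2 < w.re} ∈ 𝓝 z :=
      (isOpen_lt continuous_const Complex.continuous_re).mem_nhds (by
        change z.re / 2 < z.re; linarith)
    refine (hasDerivAt_integral_of_dominated_loc_of_deriv_le (μ := volume.restrict (Set.Ioi 0))
      (F := fun z t ↦ ((t ^ (s - 1) : ℝ) : ℂ) * Complex.exp (-(z * t)))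
      (F' := fun z t ↦ ((t ^ (s - 1) : ℝ) : ℂ) * (-t * Complex.exp (-(z * t))))
      (bound := fun t ↦ t ^ s * Real.exp (-(z.re / 2) * t)) hnb
      (.of_forall fun w ↦ (hmeas _).mul (by fun_prop)) ?_ ((hmeas _).mul (by fun_prop))
      ?_ (hint s (by linarith) _ (by linarith)) ?_).2.differentiableAt.differentiableWithinAt
    · refine Integrable.mono (hint (s - 1) (by linarith) z.re hz') ((hmeas _).mul (by fun_prop)) ?_
      refine .of_forall fun t ↦ ?_
      simp only [norm_mul, Complex.norm_exp, Complex.norm_real, Complex.neg_re,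
        Complex.re_mul_ofReal, Real.norm_eq_abs, Real.abs_exp, neg_mul]
      rfl
    · filter_upwards [ae_restrict_mem measurableSet_Ioi] with t ht w hw
      have ht' : 0 < t := ht
      have hw' : z.re / 2 < w.re := hw
      simp only [norm_mul, Complex.norm_exp, Complex.norm_real, Complex.neg_re, norm_neg,
        Complex.re_mul_ofReal]
      rw [Real.norm_of_nonneg (by positivity), Real.norm_of_nonneg ht'.le, ← mul_assoc,
        Real.rpow_sub_one ht'.ne', div_mul_cancel₀ _ ht'.ne']
      gcongr
      nlinarith
    · refine .of_forall fun t w _ ↦ ?_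
      have h := (((hasDerivAt_id w).mul_const (t : ℂ)).fun_neg.cexp).const_mul
        ((t ^ (s - 1) : ℝ) : ℂ)
      convert! h using 1
      simp only [id]
      ring
  have hA := hdiff.analyticOnNhd hopen
  have hB : AnalyticOnNhd ℂ (fun z : ℂ ↦ Complex.Gamma s * z ^ (-s : ℂ)) {z : ℂ | 0 < z.re} := by
    refine DifferentiableOn.analyticOnNhd (fun w hw ↦ ?_) hopen
    exact ((differentiableAt_id.cpow_const (Or.inl hw)).const_mul _).differentiableWithinAt
  have hreal : ∀ x : ℝ, 0 < x →
      ∫ t in Set.Ioi (0 : ℝ), ((t ^ (s - 1) : ℝ) : ℂ) * Complex.exp (-((x : ℂ) * t)) =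
        Complex.Gamma s * (x : ℂ) ^ (-s : ℂ) := fun x hx ↦ by
    have h := Complex.integral_cpow_mul_exp_neg_mul_Ioi (a := s) (r := x) (by simpa using hs) hx
    rw [one_div, Complex.inv_cpow _ _ (by
      rw [Complex.arg_ofReal_of_nonneg hx.le]; exact Real.pi_ne_zero.symm),
      ← Complex.cpow_neg] at h
    rw [mul_comm, ← h]
    refine setIntegral_congr_fun measurableSet_Ioi fun t ht ↦ ?_
    rw [Complex.ofReal_cpow (le_of_lt ht)]
    push_cast
    rfl
  refine hA.eqOn_of_preconnected_of_frequently_eq hB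
    (convex_halfSpace_re_gt 0).isPreconnected (z₀ := 1) (by simp) ?_ hz
  -- The real points 1 + 1/(n+1) accumulate at 1 without meeting it.
  have hmap : Tendsto (fun n : ℕ ↦ ((1 + 1 / ((n : ℝ) + 1) : ℝ) : ℂ)) atTop (𝓝[≠] 1) := by
    refine tendsto_nhdsWithin_iff.2 ⟨?_, .of_forall fun n ↦ ?_⟩
    · have := tendsto_one_div_add_atTop_nhds_zero_nat (𝕜 := ℝ)
      have h2 := (Complex.continuous_ofReal.tendsto _).comp (this.const_add 1)
      simpa [Function.comp_def] using h2
    · have : (0 : ℝ) < 1 / ((n : ℝ) + 1) := by positivity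
      simp only [Set.mem_compl_iff, Set.mem_singleton_iff]
      intro h
      have h3 : (1 + 1 / ((n : ℝ) + 1) : ℝ) = 1 := by exact_mod_cast h
      linarith
  refine hmap.frequently (Frequently.of_forall fun n ↦ ?_)
  exact hreal _ (by positivity)

/-- The regularized Laplace transform of a power, on the imaginary axis. -/
theorem laplaceReg_rpow {a y : ℝ} (ha : 0 < a) (ha1 : a ≤ 1) (hy : y ≠ 0) :
    laplaceReg (fun t ↦ ((t ^ (a - 1) : ℝ) : ℂ)) (fun t ↦ (((a - 1) * t ^ (a - 2) : ℝ) : ℂ))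
      (Complex.I * y) = Complex.Gamma a * (Complex.I * y) ^ (-a : ℂ) := by
  have hv1 : IntegrableOn (fun t : ℝ ↦ t ^ (a - 1)) (Set.Ioc 0 1) :=
    (intervalIntegrable_iff_integrableOn_Ioc_of_le zero_le_one).1
      (intervalIntegral.intervalIntegrable_rpow' (by linarith))
  have hw1 : IntegrableOn (fun t : ℝ ↦ (a - 1) * t ^ (a - 2)) (Set.Ioi 1) := by
    -- For a = 1 the power t^(-1) is not integrable at infinity, but its coefficient a - 1 is zero.
    rcases ha1.eq_or_lt with rfl | h
    · simp
    · exact (integrableOn_Ioi_rpow_of_lt (by linarith) one_pos).const_mul _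
  have hder : ∀ t ∈ Set.Ioi (0 : ℝ), HasDerivAt (fun t : ℝ ↦ ((t ^ (a - 1) : ℝ) : ℂ))
      (((a - 1) * t ^ (a - 2) : ℝ) : ℂ) t := fun t ht ↦ by
    have := (Real.hasDerivAt_rpow_const (x := t) (p := a - 1) (Or.inl ht.ne')).ofReal_comp
    convert this using 4
    ring
  have hz : Tendsto (fun ε : ℝ ↦ (ε : ℂ) + Complex.I * y) (𝓝[>] 0) (𝓝 (Complex.I * y)) := by
    have : Continuous fun ε : ℝ ↦ (ε : ℂ) + Complex.I * y := by fun_prop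
    have h := (this.tendsto 0).mono_left (nhdsWithin_le_nhds (s := Set.Ioi 0))
    simpa using h
  have hz0 : Complex.I * y ≠ 0 := by simp [hy]
  have hpos : ∀ᶠ ε : ℝ in 𝓝[>] 0, 0 < ε := self_mem_nhdsWithin
  have hre : ∀ ε : ℝ, ((ε : ℂ) + Complex.I * y).re = ε := fun ε ↦ by simp
  have hw2 : ContinuousOn (fun t : ℝ ↦ (((a - 1) * t ^ (a - 2) : ℝ) : ℂ)) (Set.Ioi 0) :=
    Complex.continuous_ofReal.comp_continuousOn (continuousOn_const.mul
      (continuousOn_id.rpow_const fun t ht ↦ Or.inl (ne_of_gt ht)))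
  -- At the rates ε + iy the regularized transform equals the Gamma integral, and both sides are
  -- continuous as ε → 0 because iy is off the branch cut.
  have h1 := tendsto_laplaceReg (l := 𝓝[>] (0 : ℝ))
    (v := fun _ t ↦ ((t ^ (a - 1) : ℝ) : ℂ))
    (w := fun _ t ↦ (((a - 1) * t ^ (a - 2) : ℝ) : ℂ)) (b := fun t ↦ ‖t ^ (a - 1)‖)
    (b' := fun t ↦ ‖(a - 1) * t ^ (a - 2)‖)
    (hpos.mono fun ε hε ↦ by rw [hre]; exact hε.le) hz hz0
    (.of_forall fun _ t ht ↦ (hder t ht).continuousAt.continuousWithinAt)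
    (.of_forall fun _ ↦ hw2)
    (.of_forall fun _ t _ ↦ by rw [Complex.norm_real]) hv1.norm
    (.of_forall fun _ t _ ↦ by rw [Complex.norm_real]) hw1.norm
    (fun _ _ ↦ tendsto_const_nhds) (fun _ _ ↦ tendsto_const_nhds)
  refine tendsto_nhds_unique h1 ?_
  have hslit : Complex.I * y ∈ Complex.slitPlane :=
    Complex.mem_slitPlane_iff.2 (Or.inr (by simpa using hy))
  refine (((continuousAt_cpow_const (b := (-a : ℂ)) hslit).tendsto.comp hz).const_mul
    (Complex.Gamma a)).congr' ?_
  filter_upwards [hpos] with ε hε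
  rw [Function.comp_apply, ← integral_rpow_mul_cexp_neg_mul ha (by rwa [hre])]
  refine integral_mul_cexp_eq_laplaceReg (C := 1) (by rwa [hre]) hder (fun t ht ↦ ?_)
    hv1.ofReal hw1.ofReal
  rw [Complex.norm_real, Real.norm_of_nonneg (Real.rpow_nonneg (zero_le_one.trans ht.le) _)]
  exact Real.rpow_le_one_of_one_le_of_nonpos ht.le (by linarith)

/-! ### Oscillatory integrals with the phase `x²` -/

variable {d : ℕ}

theorem continuous_pseudoInner_self (q : ℕ) :
    Continuous fun x : EuclideanSpace ℝ (Fin d) ↦ pseudoInner q x x := by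
  unfold pseudoInner
  fun_prop

theorem pseudoInner_smul_self (q : ℕ) (l : ℝ) (x : EuclideanSpace ℝ (Fin d)) :
    pseudoInner q (l • x) (l • x) = l ^ 2 * pseudoInner q x x := by
  simp only [pseudoInner, Finset.mul_sum, PiLp.smul_apply, smul_eq_mul]
  exact Finset.sum_congr rfl fun i _ ↦ by ring

theorem hasTemperateGrowth_coord (i : Fin d) :
    Function.HasTemperateGrowth fun x : EuclideanSpace ℝ (Fin d) ↦ ((x i : ℝ) : ℂ) :=
  (Complex.ofRealCLM ∘L EuclideanSpace.proj (𝕜 := ℝ) i).hasTemperateGrowth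

theorem hasTemperateGrowth_pseudoInner_self (q : ℕ) :
    Function.HasTemperateGrowth
      fun x : EuclideanSpace ℝ (Fin d) ↦ ((pseudoInner q x x : ℝ) : ℂ) := by
  have h : (fun x : EuclideanSpace ℝ (Fin d) ↦ ((pseudoInner q x x : ℝ) : ℂ)) =
      fun x ↦ ∑ i, ((metricSign q i : ℝ) : ℂ) * (((x i : ℝ) : ℂ) * ((x i : ℝ) : ℂ)) := by
    ext x; simp [pseudoInner]
  rw [h]
  have := hasTemperateGrowth_coord (d := d)
  fun_prop

/-- Multiplication of Schwartz functions by `x²`. -/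
noncomputable def squareMul (q : ℕ) :
    𝓢(EuclideanSpace ℝ (Fin d), ℂ) →L[ℂ] 𝓢(EuclideanSpace ℝ (Fin d), ℂ) :=
  SchwartzMap.smulLeftCLM ℂ fun x ↦ ((pseudoInner q x x : ℝ) : ℂ)

theorem squareMul_apply (q : ℕ) (f : 𝓢(EuclideanSpace ℝ (Fin d), ℂ))
    (x : EuclideanSpace ℝ (Fin d)) : squareMul q f x = ((pseudoInner q x x : ℝ) : ℂ) * f x :=
  SchwartzMap.smulLeftCLM_apply_apply (hasTemperateGrowth_pseudoInner_self q) f x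

/-- The Euler operator `f ↦ x · ∇f` on Schwartz functions. -/
noncomputable def euler : 𝓢(EuclideanSpace ℝ (Fin d), ℂ) →L[ℂ] 𝓢(EuclideanSpace ℝ (Fin d), ℂ) :=
  ∑ i, SchwartzMap.smulLeftCLM ℂ (fun x : EuclideanSpace ℝ (Fin d) ↦ ((x i : ℝ) : ℂ)) ∘L
    LineDeriv.lineDerivOpCLM ℂ 𝓢(EuclideanSpace ℝ (Fin d), ℂ) (EuclideanSpace.single i (1 : ℝ))

theorem euler_apply_eq_sum (f : 𝓢(EuclideanSpace ℝ (Fin d), ℂ)) (x : EuclideanSpace ℝ (Fin d)) :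
    euler f x = ∑ i, ((x i : ℝ) : ℂ) * fderiv ℝ f x (EuclideanSpace.single i 1) := by
  simp only [euler, sum_apply, ContinuousLinearMap.comp_apply]
  refine Finset.sum_congr rfl fun i _ ↦ ?_
  rw [SchwartzMap.smulLeftCLM_apply_apply (hasTemperateGrowth_coord i)]
  rfl

theorem euler_apply (f : 𝓢(EuclideanSpace ℝ (Fin d), ℂ)) (x : EuclideanSpace ℝ (Fin d)) :
    euler f x = fderiv ℝ f x x := by
  rw [euler_apply_eq_sum]
  have h : x = ∑ i, x i • EuclideanSpace.single i (1 : ℝ) := by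
    ext j
    simp [Finset.sum_apply, Pi.single_apply]
  exact ((congrArg (fderiv ℝ f x) h).trans (by simp [map_sum])).symm

/-- The phase `exp(i c x²)`. -/
noncomputable def phase (q : ℕ) (c : ℝ) (x : EuclideanSpace ℝ (Fin d)) : ℂ :=
  Complex.exp (Complex.I * ((c * pseudoInner q x x : ℝ) : ℂ))

theorem norm_phase (q : ℕ) (c : ℝ) (x : EuclideanSpace ℝ (Fin d)) : ‖phase q c x‖ = 1 := by
  rw [phase, mul_comm, Complex.norm_exp_ofReal_mul_I]

theorem continuous_phase (q : ℕ) (c : ℝ) :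
    Continuous (phase q c : EuclideanSpace ℝ (Fin d) → ℂ) := by
  have := continuous_pseudoInner_self (d := d) q
  unfold phase
  fun_prop

theorem integrable_mul_phase (q : ℕ) (c : ℝ) {f : EuclideanSpace ℝ (Fin d) → ℂ}
    (hf : Integrable f) : Integrable fun x ↦ f x * phase q c x :=
  hf.mul_bdd (c := 1) (continuous_phase q c).aestronglyMeasurable
    (.of_forall fun x ↦ (norm_phase q c x).le)

/-- The oscillatory integral `∫ f(x) exp(i c x²) dx`. -/
noncomputable def oscIntegral (q : ℕ) (c : ℝ) (f : 𝓢(EuclideanSpace ℝ (Fin d), ℂ)) : ℂ :=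
  ∫ x, f x * phase q c x

theorem oscIntegral_zero (q : ℕ) (f : 𝓢(EuclideanSpace ℝ (Fin d), ℂ)) :
    oscIntegral q 0 f = ∫ x, f x := by
  simp [oscIntegral, phase]

theorem oscIntegral_add (q : ℕ) (c : ℝ) (f g : 𝓢(EuclideanSpace ℝ (Fin d), ℂ)) :
    oscIntegral q c (f + g) = oscIntegral q c f + oscIntegral q c g := by
  rw [oscIntegral, oscIntegral, oscIntegral,
    ← integral_add (integrable_mul_phase q c f.integrable) (integrable_mul_phase q c g.integrable)]
  simp [add_mul]

theorem oscIntegral_smul (q : ℕ) (c : ℝ) (a : ℂ) (f : 𝓢(EuclideanSpace ℝ (Fin d), ℂ)) :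
    oscIntegral q c (a • f) = a * oscIntegral q c f := by
  rw [oscIntegral, oscIntegral, ← integral_const_mul]
  simp [mul_assoc]

theorem norm_oscIntegral_le (q : ℕ) (c : ℝ) (f : 𝓢(EuclideanSpace ℝ (Fin d), ℂ)) :
    ‖oscIntegral q c f‖ ≤ ∫ x, ‖f x‖ := by
  refine (norm_integral_le_integral_norm _).trans_eq ?_
  simp [norm_phase]

theorem hasDerivAt_oscIntegral (q : ℕ) (c : ℝ) (f : 𝓢(EuclideanSpace ℝ (Fin d), ℂ)) :
    HasDerivAt (fun c ↦ oscIntegral q c f) (Complex.I * oscIntegral q c (squareMul q f)) c := by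
  have hd : ∀ (x : EuclideanSpace ℝ (Fin d)) (c : ℝ), HasDerivAt (fun c ↦ f x * phase q c x)
      (Complex.I * (squareMul q f x * phase q c x)) c := fun x c ↦ by
    have h1 : HasDerivAt (fun c : ℝ ↦ ((c * pseudoInner q x x : ℝ) : ℂ))
        ((pseudoInner q x x : ℝ) : ℂ) c :=
      HasDerivAt.ofReal_comp (by simpa using (hasDerivAt_id c).mul_const (pseudoInner q x x))
    have h2 := ((h1.const_mul Complex.I).cexp).const_mul (f x)
    refine h2.congr_deriv ?_
    rw [squareMul_apply, phase]
    ring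
  have h := (hasDerivAt_integral_of_dominated_loc_of_deriv_le (μ := volume)
    (F := fun c x ↦ f x * phase q c x)
    (F' := fun c x ↦ Complex.I * (squareMul q f x * phase q c x))
    (bound := fun x ↦ ‖squareMul q f x‖) (s := Set.univ) (x₀ := c) univ_mem
    (.of_forall fun c ↦ (integrable_mul_phase q c f.integrable).aestronglyMeasurable)
    (integrable_mul_phase q c f.integrable)
    ((integrable_mul_phase q c (squareMul q f).integrable).const_mul _).aestronglyMeasurable
    (.of_forall fun x c _ ↦ by simp [norm_phase])
    (squareMul q f).integrable.norm (.of_forall fun x c _ ↦ hd x c)).2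
  rwa [integral_const_mul] at h

theorem continuous_oscIntegral (q : ℕ) (f : 𝓢(EuclideanSpace ℝ (Fin d), ℂ)) :
    Continuous fun c ↦ oscIntegral q c f :=
  continuous_iff_continuousAt.2 fun c ↦ (hasDerivAt_oscIntegral q c f).continuousAt

theorem hasFDerivAt_pseudoInner_self_single (q : ℕ) (x : EuclideanSpace ℝ (Fin d)) :
    ∃ L : EuclideanSpace ℝ (Fin d) →L[ℝ] ℝ,
      HasFDerivAt (fun x ↦ pseudoInner q x x) L x ∧
      ∀ i, L (EuclideanSpace.single i 1) = 2 * (metricSign q i * x i) := by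
  have h : ∀ i : Fin d, HasFDerivAt (fun x : EuclideanSpace ℝ (Fin d) ↦ x i)
    (EuclideanSpace.proj (𝕜 := ℝ) i) x := fun i ↦ (EuclideanSpace.proj (𝕜 := ℝ) i).hasFDerivAt
  refine ⟨_, HasFDerivAt.fun_sum fun i _ ↦ ((h i).mul (h i)).const_mul (metricSign q i),
    fun i ↦ ?_⟩
  simp [Finset.sum_add_distrib]
  ring

/-- Integration by parts: the Euler operator turns into a derivative of the phase. -/
theorem oscIntegral_euler (q : ℕ) (c : ℝ) (f : 𝓢(EuclideanSpace ℝ (Fin d), ℂ)) :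
    oscIntegral q c (euler f) =
      -(d : ℂ) * oscIntegral q c f - 2 * c * (Complex.I * oscIntegral q c (squareMul q f)) := by
  have hcoord := hasTemperateGrowth_coord (d := d)
  have hX : ∀ (i : Fin d) (g : 𝓢(EuclideanSpace ℝ (Fin d), ℂ)),
      Integrable fun x ↦ (((x i : ℝ) : ℂ) * g x) * phase q c x := fun i g ↦ by
    have := integrable_mul_phase q c
      (SchwartzMap.smulLeftCLM ℂ (fun x : EuclideanSpace ℝ (Fin d) ↦ ((x i : ℝ) : ℂ)) g).integrable
    simpa [SchwartzMap.smulLeftCLM_apply_apply (hcoord i)] using this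
  have hXd : ∀ i : Fin d, Integrable fun x ↦
      (((x i : ℝ) : ℂ) * fderiv ℝ f x (EuclideanSpace.single i 1)) * phase q c x := fun i ↦
    hX i (LineDeriv.lineDerivOpCLM ℂ 𝓢(EuclideanSpace ℝ (Fin d), ℂ)
      (EuclideanSpace.single i (1 : ℝ)) f)
  have hXX : ∀ i : Fin d, Integrable fun x ↦
      (((x i : ℝ) : ℂ) * (((x i : ℝ) : ℂ) * f x)) * phase q c x := fun i ↦ by
    have := hX i (SchwartzMap.smulLeftCLM ℂ
      (fun x : EuclideanSpace ℝ (Fin d) ↦ ((x i : ℝ) : ℂ)) f)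
    simpa [SchwartzMap.smulLeftCLM_apply_apply (hcoord i)] using this
  have hder : ∀ (i : Fin d) (x : EuclideanSpace ℝ (Fin d)),
      ∃ L : EuclideanSpace ℝ (Fin d) →L[ℝ] ℂ,
      HasFDerivAt (fun x : EuclideanSpace ℝ (Fin d) ↦ ((x i : ℝ) : ℂ) * phase q c x) L x ∧
      L (EuclideanSpace.single i 1) =
        (1 + 2 * c * Complex.I * metricSign q i * ((x i : ℝ) : ℂ) ^ 2) * phase q c x := by
    intro i x
    obtain ⟨L, hL, hLi⟩ := hasFDerivAt_pseudoInner_self_single q x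
    have h1 : HasFDerivAt (fun x : EuclideanSpace ℝ (Fin d) ↦ ((x i : ℝ) : ℂ))
      (Complex.ofRealCLM ∘L EuclideanSpace.proj (𝕜 := ℝ) i) x :=
      (Complex.ofRealCLM ∘L EuclideanSpace.proj (𝕜 := ℝ) i).hasFDerivAt
    have h2 : HasFDerivAt (fun x : EuclideanSpace ℝ (Fin d) ↦ ((c * pseudoInner q x x : ℝ) : ℂ))
      (Complex.ofRealCLM ∘L (c • L)) x :=
      Complex.ofRealCLM.hasFDerivAt.comp x (hL.const_mul c)
    have h3 := (h2.const_mul Complex.I).cexp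
    refine ⟨_, h1.mul h3, ?_⟩
    simp [hLi, phase]
    ring
  -- Integrate by parts in the i-th coordinate. The derivative of x_i exp(icx²) has the terms 1 and
  -- 2ic η_i x_i² in front of the phase; summed over i they give d and 2ic x².
  have hi : ∀ i : Fin d,
      ∫ x, (((x i : ℝ) : ℂ) * fderiv ℝ f x (EuclideanSpace.single i 1)) * phase q c x =
      -oscIntegral q c f - 2 * c * Complex.I * metricSign q i *
        ∫ x, (((x i : ℝ) : ℂ) * (((x i : ℝ) : ℂ) * f x)) * phase q c x := by
    intro i
    have hform : ∀ x : EuclideanSpace ℝ (Fin d),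
        fderiv ℝ (fun x : EuclideanSpace ℝ (Fin d) ↦ ((x i : ℝ) : ℂ) * phase q c x) x
          (EuclideanSpace.single i 1) * f x = f x * phase q c x +
          2 * c * Complex.I * metricSign q i *
            ((((x i : ℝ) : ℂ) * (((x i : ℝ) : ℂ) * f x)) * phase q c x) := fun x ↦ by
      obtain ⟨L, hL, hLi⟩ := hder i x
      rw [hL.fderiv, hLi]
      ring
    have hIP := integral_mul_fderiv_eq_neg_fderiv_mul_of_integrable (μ := volume)
      (f := fun x : EuclideanSpace ℝ (Fin d) ↦ ((x i : ℝ) : ℂ) * phase q c x) (g := f)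
      (v := EuclideanSpace.single i 1)
      (by
        simp only [hform]
        exact (integrable_mul_phase q c f.integrable).add ((hXX i).const_mul _))
      ((hXd i).congr (.of_forall fun x ↦ by simp only; ring))
      ((hX i f).congr (.of_forall fun x ↦ by simp only; ring))
      (fun x _ ↦ by obtain ⟨L, hL, -⟩ := hder i x; exact hL.differentiableAt)
      (fun x _ ↦ f.differentiableAt)
    simp only [hform] at hIP
    rw [integral_add (integrable_mul_phase q c f.integrable) ((hXX i).const_mul _),
      integral_const_mul] at hIP
    rw [oscIntegral, ← neg_add', ← hIP]
    congr 1; ext x; ring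
  have hsq : oscIntegral q c (squareMul q f) = ∑ i : Fin d, (metricSign q i : ℂ) *
      ∫ x, (((x i : ℝ) : ℂ) * (((x i : ℝ) : ℂ) * f x)) * phase q c x := by
    simp only [← integral_const_mul]
    rw [← integral_finsetSum _ fun i _ ↦ (hXX i).const_mul _, oscIntegral]
    congr 1; ext x
    simp only [squareMul_apply, pseudoInner, Complex.ofReal_sum, Finset.sum_mul]
    refine Finset.sum_congr rfl fun i _ ↦ ?_
    push_cast; ring
  have hE : oscIntegral q c (euler f) = ∑ i : Fin d,
      ∫ x, (((x i : ℝ) : ℂ) * fderiv ℝ f x (EuclideanSpace.single i 1)) * phase q c x := by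
    rw [← integral_finsetSum _ fun i _ ↦ hXd i, oscIntegral]
    congr 1; ext x
    rw [euler_apply_eq_sum, Finset.sum_mul]
  rw [hE, hsq]
  simp only [hi, Finset.sum_sub_distrib, Finset.mul_sum]
  congr 1
  · simp
  · exact Finset.sum_congr rfl fun i _ ↦ by ring

/-! ### Dilations of Schwartz functions -/

open scoped Classical in
/-- The dilation `f ↦ l^{-d} f(l⁻¹ ·)` of Schwartz functions (and `0` if `l = 0`). -/
noncomputable def dilate (l : ℝ) :
    𝓢(EuclideanSpace ℝ (Fin d), ℂ) →L[ℂ] 𝓢(EuclideanSpace ℝ (Fin d), ℂ) :=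
  if hl : l ≠ 0 then
    (((l ^ d)⁻¹ : ℝ) : ℂ) • SchwartzMap.compCLMOfContinuousLinearEquiv ℂ
      (ContinuousLinearEquiv.smulLeft (R₁ := ℝ) (M₁ := EuclideanSpace ℝ (Fin d))
        (Units.mk0 l⁻¹ (inv_ne_zero hl)))
  else 0

theorem dilate_apply {l : ℝ} (hl : l ≠ 0) (f : 𝓢(EuclideanSpace ℝ (Fin d), ℂ))
    (x : EuclideanSpace ℝ (Fin d)) :
    dilate l f x = (((l ^ d)⁻¹ : ℝ) : ℂ) * f (l⁻¹ • x) := by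
  rw [dilate, dif_pos hl]; rfl

theorem dilate_one (f : 𝓢(EuclideanSpace ℝ (Fin d), ℂ)) : dilate 1 f = f := by
  ext x; simp [dilate_apply one_ne_zero]

/-- x·∇ generates the dilations and therefore commutes with them. -/
theorem euler_dilate {l : ℝ} (hl : l ≠ 0) (f : 𝓢(EuclideanSpace ℝ (Fin d), ℂ)) :
    euler (dilate l f) = dilate l (euler f) := by
  ext x
  have h1 : HasFDerivAt (fun x : EuclideanSpace ℝ (Fin d) ↦ l⁻¹ • x)
    (l⁻¹ • ContinuousLinearMap.id ℝ _) x := (hasFDerivAt_id x).const_smul l⁻¹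
  have h2 := ((f.hasFDerivAt (l⁻¹ • x)).comp x h1).const_mul (((l ^ d)⁻¹ : ℝ) : ℂ)
  have h3 : HasFDerivAt (dilate l f) _ x :=
    h2.congr_of_eventuallyEq (.of_forall fun x ↦ dilate_apply hl f x)
  rw [euler_apply, dilate_apply hl, euler_apply, h3.fderiv]
  simp

theorem integral_dilate_mul {l : ℝ} (hl : 0 < l) (f : 𝓢(EuclideanSpace ℝ (Fin d), ℂ))
    (g : EuclideanSpace ℝ (Fin d) → ℂ) :
    ∫ x, dilate l f x * g x = ∫ x, f x * g (l • x) := by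
  have h := Measure.integral_comp_inv_smul_of_nonneg (μ := (volume : Measure
    (EuclideanSpace ℝ (Fin d)))) (fun x ↦ f x * g (l • x)) hl.le
  simp only [smul_smul, mul_inv_cancel₀ hl.ne', one_smul, finrank_euclideanSpace,
    Fintype.card_fin] at h
  simp only [dilate_apply hl.ne', mul_assoc]
  rw [integral_const_mul, h, Complex.real_smul, ← mul_assoc, ← Complex.ofReal_mul,
    inv_mul_cancel₀ (by positivity), Complex.ofReal_one, one_mul]

theorem oscIntegral_dilate (q : ℕ) (c : ℝ) {l : ℝ} (hl : 0 < l)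
    (f : 𝓢(EuclideanSpace ℝ (Fin d), ℂ)) :
    oscIntegral q c (dilate l f) = oscIntegral q (c * l ^ 2) f := by
  rw [oscIntegral, integral_dilate_mul hl, oscIntegral]
  congr 1; ext x
  rw [phase, phase, pseudoInner_smul_self, mul_assoc]

/-! ### The Fourier transform of a Gaussian with imaginary exponent -/

/-- The damping coefficients `δ + i τ η_j`. -/
noncomputable def damping (q : ℕ) (τ δ : ℝ) (i : Fin d) : ℂ :=
  δ + Complex.I * (τ * metricSign q i : ℝ)

theorem damping_ne_zero (q : ℕ) {τ : ℝ} (hτ : τ ≠ 0) (δ : ℝ) (i : Fin d) :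
    damping q τ δ i ≠ 0 := by
  intro h
  have h2 := congrArg Complex.im h
  have hm : metricSign q i ≠ 0 := fun h0 ↦ by
    have := metricSign_mul_self q i; rw [h0] at this; simp at this
  simp [damping, hτ, hm] at h2

/-- The constant `(2π)^{-d} ∏_j (π / (i τ η_j))^{1/2}`. -/
noncomputable def gaussConst (d q : ℕ) (τ : ℝ) : ℂ :=
  ((((2 * Real.pi) ^ d)⁻¹ : ℝ) : ℂ) * ∏ i : Fin d, (Real.pi / damping q τ 0 i) ^ (1 / 2 : ℂ)

theorem gaussConst_ne_zero (q : ℕ) {τ : ℝ} (hτ : τ ≠ 0) : gaussConst d q τ ≠ 0 := by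
  refine mul_ne_zero (by
    rw [Complex.ofReal_ne_zero]; positivity) (Finset.prod_ne_zero_iff.2 fun i _ ↦ ?_)
  rw [Complex.cpow_ne_zero_iff]
  left
  exact div_ne_zero (by exact_mod_cast Real.pi_ne_zero) (damping_ne_zero q hτ 0 i)

/-- The damped Gaussian `exp(-t (δ|p|² + i τ p²))`. -/
noncomputable def dampedGauss (q : ℕ) (τ δ t : ℝ) (p : EuclideanSpace ℝ (Fin d)) : ℂ :=
  Complex.exp (-∑ i, t * damping q τ δ i * (p i : ℂ) ^ 2)

theorem continuous_dampedGauss (q : ℕ) (τ δ t : ℝ) :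
    Continuous (dampedGauss q τ δ t : EuclideanSpace ℝ (Fin d) → ℂ) := by
  unfold dampedGauss; fun_prop

theorem dampedGauss_zero (q : ℕ) (τ t : ℝ) (p : EuclideanSpace ℝ (Fin d)) :
    dampedGauss q τ 0 t p = phase q (-(τ * t)) p := by
  rw [dampedGauss, phase, pseudoInner, Finset.mul_sum, Complex.ofReal_sum, Finset.mul_sum,
    ← Finset.sum_neg_distrib]
  congr 1
  refine Finset.sum_congr rfl fun i _ ↦ ?_
  simp only [damping]
  push_cast
  ring

theorem norm_dampedGauss_le (q : ℕ) (τ : ℝ) {δ t : ℝ} (hδ : 0 ≤ δ) (ht : 0 ≤ t)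
    (p : EuclideanSpace ℝ (Fin d)) : ‖dampedGauss q τ δ t p‖ ≤ 1 := by
  rw [dampedGauss, Complex.norm_exp, Real.exp_le_one_iff, Complex.neg_re, neg_nonpos,
    Complex.re_sum]
  refine Finset.sum_nonneg fun i _ ↦ ?_
  have : ((t : ℂ) * damping q τ δ i * (p i : ℂ) ^ 2).re = t * δ * p i ^ 2 := by
    rw [← Complex.ofReal_pow, Complex.re_mul_ofReal, Complex.re_ofReal_mul]
    simp [damping]
  rw [this]
  positivity

theorem integral_euclidean_gauss {b : Fin d → ℂ} (hb : ∀ i, 0 < (b i).re) (c : Fin d → ℂ) :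
    ∫ p : EuclideanSpace ℝ (Fin d),
      Complex.exp (-∑ i, b i * (p i : ℂ) ^ 2 + ∑ i, c i * p i) =
      ∏ i, (Real.pi / b i) ^ (1 / 2 : ℂ) * Complex.exp (c i ^ 2 / (4 * b i)) := by
  rw [← (PiLp.volume_preserving_toLp (Fin d)).integral_comp
    (MeasurableEquiv.toLp 2 _).measurableEmbedding]
  exact GaussianFourier.integral_cexp_neg_sum_mul_add hb c

theorem integrable_dampedGauss (q : ℕ) (τ : ℝ) {δ t : ℝ} (hδ : 0 < δ) (ht : 0 < t) :
    Integrable (dampedGauss q τ δ t : EuclideanSpace ℝ (Fin d) → ℂ) := by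
  rw [← (PiLp.volume_preserving_toLp (Fin d)).integrable_comp_emb
    (MeasurableEquiv.toLp 2 _).measurableEmbedding]
  have h := GaussianFourier.integrable_cexp_neg_sum_mul_add (ι := Fin d)
    (b := fun i ↦ t * damping q τ δ i) (fun i ↦ by
      rw [Complex.re_ofReal_mul]; simp [damping]; positivity) 0
  refine h.congr (.of_forall fun v ↦ ?_)
  simp [dampedGauss]

/-- The damping makes the Gaussian integrable, so Fubini applies and the inner integral is a product
of one-dimensional Gaussians. The signs η_i disappear from the numerators -x_i² because η_i² = 1. -/
theorem integral_testFourier_mul_dampedGauss (q : ℕ) (τ : ℝ) {δ t : ℝ} (hδ : 0 < δ) (ht : 0 < t)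
    (f : 𝓢(EuclideanSpace ℝ (Fin d), ℂ)) :
    ∫ p, testFourier d q f p * dampedGauss q τ δ t p =
      (((2 * Real.pi) ^ d)⁻¹ : ℝ) * (∏ i : Fin d, (Real.pi / (t * damping q τ δ i)) ^ (1 / 2 : ℂ)) *
        ∫ x, f x * ∏ i, Complex.exp (-(x i : ℂ) ^ 2 / (4 * (t * damping q τ δ i))) := by
  have hswap := integral_integral_swap (μ := (volume : Measure (EuclideanSpace ℝ (Fin d))))
    (ν := (volume : Measure (EuclideanSpace ℝ (Fin d))))
    (f := fun p x ↦ Complex.exp (Complex.I * (pseudoInner q p x : ℂ)) * f x *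
      dampedGauss q τ δ t p) (by
      have h := (integrable_dampedGauss (d := d) q τ hδ ht).mul_prod (f.integrable (μ := volume))
      have hc : Continuous fun z : EuclideanSpace ℝ (Fin d) × EuclideanSpace ℝ (Fin d) ↦
          Complex.exp (Complex.I * (pseudoInner q z.1 z.2 : ℂ)) := by
        unfold pseudoInner; fun_prop
      refine (h.bdd_mul (c := 1) hc.aestronglyMeasurable (.of_forall fun z ↦ ?_)).congr
        (.of_forall fun z ↦ ?_)
      · rw [mul_comm, Complex.norm_exp_ofReal_mul_I]
      · simp only [Function.uncurry]; ring)
  have hinner : ∀ x : EuclideanSpace ℝ (Fin d),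
      ∫ p, Complex.exp (Complex.I * (pseudoInner q p x : ℂ)) * f x * dampedGauss q τ δ t p =
      (∏ i : Fin d, (Real.pi / (t * damping q τ δ i)) ^ (1 / 2 : ℂ)) *
        (f x * ∏ i, Complex.exp (-(x i : ℂ) ^ 2 / (4 * (t * damping q τ δ i)))) := fun x ↦ by
    have h := integral_euclidean_gauss (d := d) (b := fun i ↦ t * damping q τ δ i) (fun i ↦ by
      rw [Complex.re_ofReal_mul]; simp [damping]; positivity)
      (fun i ↦ Complex.I * (metricSign q i * x i : ℝ))
    have hpt : ∀ p : EuclideanSpace ℝ (Fin d),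
        Complex.exp (Complex.I * (pseudoInner q p x : ℂ)) * f x * dampedGauss q τ δ t p =
        f x * Complex.exp (-∑ i, t * damping q τ δ i * (p i : ℂ) ^ 2 +
          ∑ i, Complex.I * (metricSign q i * x i : ℝ) * p i) := fun p ↦ by
      rw [Complex.exp_add, dampedGauss, pseudoInner, Complex.ofReal_sum, Finset.mul_sum]
      have : ∀ i, Complex.I * ((metricSign q i * (p i * x i) : ℝ) : ℂ) =
          Complex.I * (metricSign q i * x i : ℝ) * p i := fun i ↦ by push_cast; ring
      simp only [this]
      ring
    have hs : ∀ i, (Complex.I * (metricSign q i * x i : ℝ)) ^ 2 = -(x i : ℂ) ^ 2 := fun i ↦ by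
      have h2 : (metricSign q i : ℂ) * metricSign q i = 1 := by
        exact_mod_cast metricSign_mul_self q i
      push_cast
      linear_combination (metricSign q i * metricSign q i * (x i : ℂ) ^ 2) * Complex.I_mul_I -
        (x i : ℂ) ^ 2 * h2
    simp only [hpt]
    rw [integral_const_mul, h, Finset.prod_mul_distrib]
    simp only [hs]
    ring
  have hout : ∀ p, testFourier d q f p * dampedGauss q τ δ t p = (((2 * Real.pi) ^ d)⁻¹ : ℝ) *
      ∫ x, Complex.exp (Complex.I * (pseudoInner q p x : ℂ)) * f x * dampedGauss q τ δ t p :=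
    fun p ↦ by rw [testFourier_apply, mul_assoc, ← integral_mul_const]
  simp only [hout]
  rw [integral_const_mul, hswap]
  simp only [hinner]
  rw [integral_const_mul, mul_assoc]

theorem tendsto_damping (q : ℕ) (τ : ℝ) (i : Fin d) :
    Tendsto (fun δ ↦ damping q τ δ i) (𝓝[>] 0) (𝓝 (damping q τ 0 i)) := by
  have : Continuous fun δ ↦ damping q τ δ i := by unfold damping; fun_prop
  exact (this.tendsto 0).mono_left nhdsWithin_le_nhds

/-- Inversion preserves the half-plane Re ≥ 0. The bound is uniform in δ and provides the domination
for δ → 0. -/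
theorem norm_cexp_neg_sq_div_le (q : ℕ) (τ : ℝ) {δ t : ℝ} (hδ : 0 ≤ δ) (ht : 0 ≤ t) (i : Fin d)
    (r : ℝ) : ‖Complex.exp (-(r : ℂ) ^ 2 / (4 * (t * damping q τ δ i)))‖ ≤ 1 := by
  rw [Complex.norm_exp, Real.exp_le_one_iff]
  have h : (-(r : ℂ) ^ 2 / (4 * (t * damping q τ δ i))) =
      ((-(r ^ 2 / (4 * t)) : ℝ) : ℂ) * (damping q τ δ i)⁻¹ := by
    push_cast
    rw [div_eq_mul_inv, mul_inv, mul_inv, div_eq_mul_inv, mul_inv]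
    ring
  rw [h, Complex.re_ofReal_mul, Complex.inv_re]
  have : (damping q τ δ i).re = δ := by simp [damping]
  rw [this, neg_mul, neg_nonpos]
  have := Complex.normSq_nonneg (damping q τ δ i)
  positivity

theorem inv_damping_zero (q : ℕ) {τ : ℝ} (hτ : τ * τ = 1) (i : Fin d) :
    (damping q τ 0 i)⁻¹ = -Complex.I * (τ * metricSign q i : ℝ) := by
  refine inv_eq_of_mul_eq_one_right ?_
  have h1 : (τ : ℂ) * τ = 1 := by exact_mod_cast hτ
  have h2 : (metricSign q i : ℂ) * metricSign q i = 1 := by exact_mod_cast metricSign_mul_self q i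
  simp only [damping]
  push_cast
  linear_combination (-(Complex.I * Complex.I) * metricSign q i * metricSign q i) * h1 -
    (Complex.I * Complex.I) * h2 - Complex.I_mul_I

/-- A positive real factor can be taken out of a principal power without crossing the cut. -/
theorem div_mul_damping_cpow (q : ℕ) {τ : ℝ} (hτ : τ ≠ 0) {t : ℝ} (ht : 0 < t) (i : Fin d) :
    (Real.pi / (t * damping q τ 0 i)) ^ (1 / 2 : ℂ) =
      ((t ^ (-(1 / 2) : ℝ) : ℝ) : ℂ) * (Real.pi / damping q τ 0 i) ^ (1 / 2 : ℂ) := by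
  have hne : (Real.pi : ℂ) / damping q τ 0 i ≠ 0 :=
    div_ne_zero (by exact_mod_cast Real.pi_ne_zero) (damping_ne_zero q hτ 0 i)
  have h : (Real.pi : ℂ) / (t * damping q τ 0 i) =
      ((t⁻¹ : ℝ) : ℂ) * (Real.pi / damping q τ 0 i) := by
    push_cast; rw [div_eq_mul_inv, div_eq_mul_inv, mul_inv]; ring
  have ht' : ((t⁻¹ : ℝ) : ℂ) ≠ 0 := by rw [Complex.ofReal_ne_zero]; positivity
  rw [h, Complex.cpow_def_of_ne_zero (mul_ne_zero ht' hne), Complex.cpow_def_of_ne_zero hne,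
    Complex.log_ofReal_mul (by positivity) hne, Real.rpow_def_of_pos ht, Real.log_inv, add_mul,
    Complex.exp_add]
  push_cast
  ring_nf

/-- The Fourier transform of `exp(-i τ t p²)`. -/
theorem integral_testFourier_mul_phase (q : ℕ) {τ : ℝ} (hτ : τ * τ = 1) {t : ℝ} (ht : 0 < t)
    (f : 𝓢(EuclideanSpace ℝ (Fin d), ℂ)) :
    ∫ p, testFourier d q f p * phase q (-(τ * t)) p =
      gaussConst d q τ * ((t ^ (-(d / 2) : ℝ) : ℝ) : ℂ) * oscIntegral q (τ / (4 * t)) f := by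
  have hτ0 : τ ≠ 0 := by rintro rfl; simp at hτ
  have hpos : ∀ᶠ δ : ℝ in 𝓝[>] 0, 0 < δ := self_mem_nhdsWithin
  -- Let δ → 0 on both sides of the damped identity, with the dominating functions |testFourier f|
  -- and |f|.
  have hL : Tendsto (fun δ ↦ ∫ p, testFourier d q f p * dampedGauss q τ δ t p) (𝓝[>] 0)
      (𝓝 (∫ p, testFourier d q f p * phase q (-(τ * t)) p)) := by
    refine tendsto_integral_filter_of_dominated_convergence (fun p ↦ ‖testFourier d q f p‖)
      (.of_forall fun δ ↦ ((testFourier d q f).continuous.mul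
        (continuous_dampedGauss q τ δ t)).aestronglyMeasurable) ?_
      (testFourier d q f).integrable.norm (.of_forall fun p ↦ ?_)
    · filter_upwards [hpos] with δ hδ
      refine .of_forall fun p ↦ ?_
      rw [norm_mul]
      exact mul_le_of_le_one_right (norm_nonneg _) (norm_dampedGauss_le q τ hδ.le ht.le p)
    · rw [← dampedGauss_zero]
      refine Tendsto.const_mul _ (((Complex.continuous_exp.tendsto _).comp (tendsto_finsetSum _
        fun i _ ↦ ((tendsto_damping q τ i).const_mul (t : ℂ)).mul_const _).neg))
  have hinv : ∀ i : Fin d, Tendsto (fun δ ↦ (4 * ((t : ℂ) * damping q τ δ i))) (𝓝[>] 0)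
      (𝓝 (4 * (t * damping q τ 0 i))) := fun i ↦
    ((tendsto_damping q τ i).const_mul (t : ℂ)).const_mul 4
  have ht0 : (t : ℂ) ≠ 0 := by exact_mod_cast ht.ne'
  have hne : ∀ i : Fin d, (t : ℂ) * damping q τ 0 i ≠ 0 := fun i ↦
    mul_ne_zero ht0 (damping_ne_zero q hτ0 0 i)
  have hR : Tendsto (fun δ ↦ (((2 * Real.pi) ^ d)⁻¹ : ℝ) *
      (∏ i : Fin d, (Real.pi / (t * damping q τ δ i)) ^ (1 / 2 : ℂ)) *
        ∫ x, f x * ∏ i, Complex.exp (-(x i : ℂ) ^ 2 / (4 * (t * damping q τ δ i)))) (𝓝[>] 0)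
      (𝓝 ((((2 * Real.pi) ^ d)⁻¹ : ℝ) *
      (∏ i : Fin d, (Real.pi / (t * damping q τ 0 i)) ^ (1 / 2 : ℂ)) *
        ∫ x, f x * ∏ i, Complex.exp (-(x i : ℂ) ^ 2 / (4 * (t * damping q τ 0 i))))) := by
    refine (Tendsto.const_mul _ (tendsto_finsetProd _ fun i _ ↦ ?_)).mul ?_
    -- The limiting base is purely imaginary and nonzero, so the principal power is continuous
    -- there.
    · have hslit : (Real.pi : ℂ) / (t * damping q τ 0 i) ∈ Complex.slitPlane := by
        refine Complex.mem_slitPlane_iff.2 (Or.inr ?_)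
        have h : (Real.pi : ℂ) / (t * damping q τ 0 i) =
            ((Real.pi / t * -(τ * metricSign q i) : ℝ) : ℂ) * Complex.I := by
          rw [div_eq_mul_inv, mul_inv, inv_damping_zero q hτ]; push_cast; ring
        have hm : metricSign q i ≠ 0 := fun h0 ↦ by
          have := metricSign_mul_self q i; rw [h0] at this; simp at this
        rw [h, Complex.im_ofReal_mul, Complex.I_im, mul_one]
        exact mul_ne_zero (div_ne_zero Real.pi_ne_zero ht.ne') (neg_ne_zero.2 (mul_ne_zero hτ0 hm))
      exact ((continuousAt_cpow_const hslit).tendsto).comp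
        (tendsto_const_nhds.div ((tendsto_damping q τ i).const_mul (t : ℂ)) (hne i))
    · refine tendsto_integral_filter_of_dominated_convergence (fun x ↦ ‖f x‖)
        (.of_forall fun δ ↦ Continuous.aestronglyMeasurable (by
          have := f.continuous; fun_prop)) ?_ f.integrable.norm (.of_forall fun x ↦ ?_)
      · filter_upwards [hpos] with δ hδ
        refine .of_forall fun x ↦ ?_
        rw [norm_mul, norm_prod]
        exact mul_le_of_le_one_right (norm_nonneg _) (Finset.prod_le_one
          (fun _ _ ↦ norm_nonneg _) fun i _ ↦ norm_cexp_neg_sq_div_le q τ hδ.le ht.le i _)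
      · exact Tendsto.const_mul _ (tendsto_finsetProd _ fun i _ ↦
          (Complex.continuous_exp.tendsto _).comp
            (tendsto_const_nhds.div (hinv i) (mul_ne_zero (by norm_num) (hne i))))
  have hlim := tendsto_nhds_unique (hL.congr' (by
    filter_upwards [hpos] with δ hδ
    exact integral_testFourier_mul_dampedGauss q τ hδ ht f)) hR
  rw [hlim]
  simp only [div_mul_damping_cpow q hτ0 ht, Finset.prod_mul_distrib, Finset.prod_const,
    Finset.card_univ, Fintype.card_fin]
  have hpow : ((t ^ (-(1 / 2) : ℝ) : ℝ) : ℂ) ^ d = ((t ^ (-(d / 2) : ℝ) : ℝ) : ℂ) := by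
    rw [← Complex.ofReal_pow, ← Real.rpow_natCast, ← Real.rpow_mul ht.le]
    congr 2; ring
  have hph : ∀ x : EuclideanSpace ℝ (Fin d),
      ∏ i, Complex.exp (-(x i : ℂ) ^ 2 / (4 * (t * damping q τ 0 i))) =
        phase q (τ / (4 * t)) x := fun x ↦ by
    rw [← Complex.exp_sum, phase, pseudoInner, Finset.mul_sum, Complex.ofReal_sum, Finset.mul_sum]
    congr 1
    refine Finset.sum_congr rfl fun i _ ↦ ?_
    rw [div_eq_mul_inv, mul_inv, mul_inv, inv_damping_zero q hτ]
    push_cast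
    field_simp
  simp only [hph, hpow, gaussConst, oscIntegral]
  ring

/-- The decay of stationary phase, obtained by reading `integral_testFourier_mul_phase` backwards:
its left side is bounded uniformly in t. -/
theorem norm_oscIntegral_le_rpow (q : ℕ) {τ : ℝ} (hτ : τ * τ = 1) {t : ℝ} (ht : 0 < t)
    (f : 𝓢(EuclideanSpace ℝ (Fin d), ℂ)) :
    ‖oscIntegral q (τ / (4 * t)) f‖ ≤
      t ^ (d / 2 : ℝ) * (‖gaussConst d q τ‖⁻¹ * ∫ p, ‖testFourier d q f p‖) := by
  have hτ0 : τ ≠ 0 := by rintro rfl; simp at hτ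
  have hg : 0 < ‖gaussConst d q τ‖ := norm_pos_iff.2 (gaussConst_ne_zero q hτ0)
  have h1 : ‖∫ p, testFourier d q f p * phase q (-(τ * t)) p‖ ≤ ∫ p, ‖testFourier d q f p‖ :=
    norm_oscIntegral_le q _ (testFourier d q f)
  rw [integral_testFourier_mul_phase q hτ ht, norm_mul, norm_mul, Complex.norm_real,
    Real.norm_of_nonneg (by positivity), Real.rpow_neg ht.le] at h1
  have htp : 0 < t ^ (d / 2 : ℝ) := by positivity
  rw [← mul_assoc, ← div_eq_mul_inv, div_mul_eq_mul_div, le_div_iff₀ hg]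
  rw [← div_eq_mul_inv, div_mul_eq_mul_div, div_le_iff₀ htp] at h1
  linarith

/-! ### The Schwinger representation -/

/-- The integrand `t^{s-1-d/2} ∫ f(x) exp(i τ x² / (4t)) dx` of the Schwinger representation. -/
noncomputable def schwinger (q : ℕ) (τ s : ℝ) (f : 𝓢(EuclideanSpace ℝ (Fin d), ℂ)) (t : ℝ) : ℂ :=
  ((t ^ (s - 1 - d / 2) : ℝ) : ℂ) * oscIntegral q (τ / (4 * t)) f

/-- The constant in the Schwinger representation. -/
noncomputable def schwingerConst (d q : ℕ) (τ s : ℝ) : ℂ :=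
  (-(Complex.I * τ)) ^ (-s : ℂ) * (Complex.Gamma s)⁻¹ * gaussConst d q τ

theorem schwingerConst_ne_zero (q : ℕ) {τ s : ℝ} (hτ : τ ≠ 0) (hs : 0 < s) :
    schwingerConst d q τ s ≠ 0 := by
  refine mul_ne_zero (mul_ne_zero ?_ (inv_ne_zero ?_)) (gaussConst_ne_zero q hτ)
  · rw [Complex.cpow_ne_zero_iff]
    left
    simp [hτ]
  · exact Complex.Gamma_ne_zero_of_re_pos (by simpa using hs)

/-- The arguments satisfy |arg z| < π/2 and |arg c| ≤ π/2, so their sum stays inside (-π, π) and the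
logarithms add. -/
theorem mul_cpow_of_re_pos {z c : ℂ} (hz : 0 < z.re) (hc : c ≠ 0) (hc' : 0 ≤ c.re) (r : ℂ) :
    (c * z) ^ r = c ^ r * z ^ r := by
  have hz0 : z ≠ 0 := by rintro rfl; simp at hz
  have h1 := abs_lt.1 (Complex.abs_arg_lt_pi_div_two_iff.2 (Or.inl hz))
  have h2 := abs_le.1 (Complex.abs_arg_le_pi_div_two_iff.2 hc')
  rw [Complex.cpow_def_of_ne_zero (mul_ne_zero hc hz0), Complex.cpow_def_of_ne_zero hc,
    Complex.cpow_def_of_ne_zero hz0, Complex.log_mul hc hz0 ⟨by linarith, by linarith⟩, add_mul,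
    Complex.exp_add]

theorem re_add_I_mul (ε r : ℝ) : ((ε : ℂ) + Complex.I * (r : ℂ)).re = ε := by simp

/-- The rotation by -iτ connects the symbol, whose base may have any real part, with a base of real
part ε > 0, for which the Gamma integral converges. -/
theorem symbol_eq (q : ℕ) {τ σ : ℝ} (hτ : τ * τ = 1) (hσ : σ = -τ) (μ m : ℝ) {ε : ℝ} (hε : 0 < ε)
    (p : EuclideanSpace ℝ (Fin d)) :
    symbol q μ m (σ * ε) p = (-(Complex.I * τ)) ^ (-((μ / 2 : ℝ) : ℂ)) *
      ((ε + Complex.I * (τ * (m ^ 2 + pseudoInner q p p) : ℝ)) ^ (-((μ / 2 : ℝ) : ℂ))) := by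
  have hτ0 : τ ≠ 0 := by rintro rfl; simp at hτ
  have hτ' : (τ : ℂ) * τ = 1 := by exact_mod_cast hτ
  rw [← mul_cpow_of_re_pos (by rwa [re_add_I_mul]) (by simp [hτ0]) (by simp), symbol,
    Complex.cpow_neg, one_div]
  congr 2
  subst hσ
  push_cast
  linear_combination (Complex.I * Complex.I * (m ^ 2 + pseudoInner q p p)) * hτ' +
    (m ^ 2 + pseudoInner q p p : ℂ) * Complex.I_mul_I

theorem integral_testFourier_mul_symbol (q : ℕ) {τ σ : ℝ} (hτ : τ * τ = 1) (hσ : σ = -τ)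
    {μ : ℝ} (hμ : 0 < μ) (m : ℝ) {ε : ℝ} (hε : 0 < ε) (f : 𝓢(EuclideanSpace ℝ (Fin d), ℂ)) :
    ∫ p, testFourier d q f p * symbol q μ m (σ * ε) p = schwingerConst d q τ (μ / 2) *
      ∫ t in Set.Ioi 0, schwinger q τ (μ / 2) f t *
        Complex.exp (-((ε + Complex.I * (τ * m ^ 2 : ℝ)) * t)) := by
  have hs : 0 < μ / 2 := by positivity
  generalize hsdef : μ / 2 = s at hs
  have hG : Complex.Gamma s ≠ 0 := Complex.Gamma_ne_zero_of_re_pos (by simpa using hs)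
  have hcont := continuous_pseudoInner_self (d := d) q
  have hint : IntegrableOn (fun t : ℝ ↦ t ^ (s - 1) * Real.exp (-ε * t)) (Set.Ioi 0) := by
    simpa using integrableOn_rpow_mul_exp_neg_mul_rpow (s := s - 1) (by linarith) one_pos hε
  -- The dependence on both p and t sits in a phase of modulus one; the rest is a product of
  -- integrable functions of p and of t. This justifies Fubini.
  have hsplit : ∀ (p : EuclideanSpace ℝ (Fin d)) (t : ℝ),
      testFourier d q f p * (((t ^ (s - 1) : ℝ) : ℂ) *
        Complex.exp (-((ε + Complex.I * (τ * (m ^ 2 + pseudoInner q p p) : ℝ)) * t))) =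
      phase q (-(τ * t)) p * (testFourier d q f p * (((t ^ (s - 1) : ℝ) : ℂ) *
        Complex.exp (-((ε + Complex.I * (τ * m ^ 2 : ℝ)) * t)))) := fun p t ↦ by
    have : Complex.exp (-((ε + Complex.I * (τ * (m ^ 2 + pseudoInner q p p) : ℝ)) * t)) =
        phase q (-(τ * t)) p * Complex.exp (-((ε + Complex.I * (τ * m ^ 2 : ℝ)) * t)) := by
      rw [phase, ← Complex.exp_add]
      congr 1; push_cast; ring
    rw [this]; ring
  have hexp : ∀ t : ℝ, ‖((t ^ (s - 1) : ℝ) : ℂ) *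
      Complex.exp (-((ε + Complex.I * (τ * m ^ 2 : ℝ)) * t))‖ =
      ‖t ^ (s - 1) * Real.exp (-ε * t)‖ := fun t ↦ by
    rw [norm_mul, norm_mul, Complex.norm_exp, Complex.norm_real, Complex.neg_re,
      Complex.re_mul_ofReal, re_add_I_mul, Real.norm_of_nonneg (Real.exp_pos _).le, neg_mul]
  have hintc : IntegrableOn (fun t : ℝ ↦ ((t ^ (s - 1) : ℝ) : ℂ) *
      Complex.exp (-((ε + Complex.I * (τ * m ^ 2 : ℝ)) * t))) (Set.Ioi 0) := by
    refine Integrable.mono hint (Measurable.aestronglyMeasurable (by fun_prop))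
      (.of_forall fun t ↦ (hexp t).le)
  have hswap := integral_integral_swap (μ := (volume : Measure (EuclideanSpace ℝ (Fin d))))
    (ν := volume.restrict (Set.Ioi 0))
    (f := fun p t ↦ testFourier d q f p * (((t ^ (s - 1) : ℝ) : ℂ) *
      Complex.exp (-((ε + Complex.I * (τ * (m ^ 2 + pseudoInner q p p) : ℝ)) * t)))) (by
      have hph : Continuous fun z : EuclideanSpace ℝ (Fin d) × ℝ ↦ phase q (-(τ * z.2)) z.1 := by
        have h2 : Continuous fun z : EuclideanSpace ℝ (Fin d) × ℝ ↦ pseudoInner q z.1 z.1 :=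
          hcont.comp continuous_fst
        unfold phase; fun_prop
      refine (((testFourier d q f).integrable.mul_prod hintc).bdd_mul (c := 1)
        hph.aestronglyMeasurable (.of_forall fun z ↦ (norm_phase _ _ _).le)).congr
        (.of_forall fun z ↦ ?_)
      exact (hsplit z.1 z.2).symm)
  have hL : ∀ p, testFourier d q f p * symbol q μ m (σ * ε) p =
      ((-(Complex.I * τ)) ^ (-s : ℂ) * (Complex.Gamma s)⁻¹) * ∫ t in Set.Ioi 0,
        testFourier d q f p * (((t ^ (s - 1) : ℝ) : ℂ) *
          Complex.exp (-((ε + Complex.I * (τ * (m ^ 2 + pseudoInner q p p) : ℝ)) * t))) :=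
    fun p ↦ by
      rw [integral_const_mul, integral_rpow_mul_cexp_neg_mul hs (by rwa [re_add_I_mul]),
        symbol_eq q hτ hσ μ m hε, hsdef]
      field_simp
  have hR : ∀ t ∈ Set.Ioi (0 : ℝ), ∫ p, testFourier d q f p * (((t ^ (s - 1) : ℝ) : ℂ) *
      Complex.exp (-((ε + Complex.I * (τ * (m ^ 2 + pseudoInner q p p) : ℝ)) * t))) =
      gaussConst d q τ * (schwinger q τ s f t *
        Complex.exp (-((ε + Complex.I * (τ * m ^ 2 : ℝ)) * t))) := fun t ht ↦ by
    have ht' : 0 < t := ht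
    have h1 : ∀ p, testFourier d q f p * (((t ^ (s - 1) : ℝ) : ℂ) *
        Complex.exp (-((ε + Complex.I * (τ * (m ^ 2 + pseudoInner q p p) : ℝ)) * t))) =
        (((t ^ (s - 1) : ℝ) : ℂ) * Complex.exp (-((ε + Complex.I * (τ * m ^ 2 : ℝ)) * t))) *
          (testFourier d q f p * phase q (-(τ * t)) p) := fun p ↦ by
      rw [hsplit]; ring
    simp only [h1]
    rw [integral_const_mul, integral_testFourier_mul_phase q hτ ht', schwinger,
      sub_eq_add_neg (s - 1), Real.rpow_add ht']
    push_cast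
    ring
  simp only [hL]
  rw [integral_const_mul, hswap, setIntegral_congr_fun measurableSet_Ioi hR, integral_const_mul,
    schwingerConst]
  ring

/-! ### Estimates for the Schwinger integrand -/

/-- The operator `s + ½ x · ∇`, which lowers the index of the Schwinger integrand. -/
noncomputable def eulerShift (s : ℝ) :
    𝓢(EuclideanSpace ℝ (Fin d), ℂ) →L[ℂ] 𝓢(EuclideanSpace ℝ (Fin d), ℂ) :=
  (s : ℂ) • ContinuousLinearMap.id ℂ _ + (1 / 2 : ℂ) • euler

theorem eulerShift_apply (s : ℝ) (f : 𝓢(EuclideanSpace ℝ (Fin d), ℂ)) :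
    eulerShift s f = (s : ℂ) • f + (1 / 2 : ℂ) • euler f := rfl

theorem eulerShift_dilate (s : ℝ) {l : ℝ} (hl : l ≠ 0) (f : 𝓢(EuclideanSpace ℝ (Fin d), ℂ)) :
    eulerShift s (dilate l f) = dilate l (eulerShift s f) := by
  simp only [eulerShift_apply, euler_dilate hl, map_add, map_smul]

theorem oscIntegral_eulerShift (q : ℕ) (s c : ℝ) (f : 𝓢(EuclideanSpace ℝ (Fin d), ℂ)) :
    oscIntegral q c (eulerShift s f) = ((s - d / 2 : ℝ) : ℂ) * oscIntegral q c f -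
      c * (Complex.I * oscIntegral q c (squareMul q f)) := by
  rw [eulerShift_apply, oscIntegral_add, oscIntegral_smul, oscIntegral_smul, oscIntegral_euler]
  push_cast
  ring

/-- The phase is trivial at c = 0. The factor s - d/2 is nonzero for s > d/2, which keeps the
constants in the induction on s nonzero, and vanishes for s = d/2, the critical index. -/
theorem integral_eulerShift (s : ℝ) (f : 𝓢(EuclideanSpace ℝ (Fin d), ℂ)) :
    ∫ x, eulerShift s f x = ((s - d / 2 : ℝ) : ℂ) * ∫ x, f x := by
  rw [← oscIntegral_zero 0, oscIntegral_eulerShift, oscIntegral_zero]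
  simp

/-- The oscillatory integral depends on t through c = τ/(4t), so t∂_t acts on it as -c∂_c, which by
`oscIntegral_euler` is f ↦ (d/2 + ½ x·∇)f. The power t^(s-d/2) contributes s - d/2, and the sum is s
+ ½ x·∇. -/
theorem hasDerivAt_schwinger (q : ℕ) (τ s : ℝ) (f : 𝓢(EuclideanSpace ℝ (Fin d), ℂ)) {t : ℝ}
    (ht : 0 < t) :
    HasDerivAt (schwinger q τ (s + 1) f) (schwinger q τ s (eulerShift s f) t) t := by
  have h1 : HasDerivAt (fun t : ℝ ↦ ((t ^ (s + 1 - 1 - d / 2) : ℝ) : ℂ))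
      (((s - d / 2) * t ^ (s - 1 - d / 2) : ℝ) : ℂ) t := by
    have := (Real.hasDerivAt_rpow_const (x := t) (p := s + 1 - 1 - d / 2)
      (Or.inl ht.ne')).ofReal_comp
    convert! this using 2
    ring_nf
  have h2 : HasDerivAt (fun t : ℝ ↦ τ / (4 * t)) (-(τ / (4 * t)) / t) t := by
    have := ((hasDerivAt_id t).const_mul 4).inv (by simpa using ht.ne') |>.const_mul τ
    convert! this using 1
    simp only [id, mul_one]
    field_simp
  have h3 : HasDerivAt (fun t : ℝ ↦ oscIntegral q (τ / (4 * t)) f)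
      ((-(τ / (4 * t)) / t : ℝ) • (Complex.I * oscIntegral q (τ / (4 * t)) (squareMul q f))) t :=
    HasDerivAt.scomp (g₁ := fun c ↦ oscIntegral q c f) t (hasDerivAt_oscIntegral q _ f) h2
  have h4 : HasDerivAt (schwinger q τ (s + 1) f) _ t := h1.mul h3
  refine h4.congr_deriv ?_
  have hp : t ^ (s + 1 - 1 - d / 2) = t ^ (s - 1 - d / 2) * t := by
    rw [← Real.rpow_add_one ht.ne']; congr 1; ring
  have ht0 : (t : ℂ) ≠ 0 := by exact_mod_cast ht.ne'
  rw [schwinger, oscIntegral_eulerShift, hp, Complex.real_smul]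
  push_cast
  field_simp
  ring

theorem continuousOn_schwinger (q : ℕ) (τ s : ℝ) (f : 𝓢(EuclideanSpace ℝ (Fin d), ℂ)) :
    ContinuousOn (schwinger q τ s f) (Set.Ioi 0) := fun t ht ↦ by
  have h := (hasDerivAt_schwinger q τ (s - 1) f ht).continuousAt
  rw [sub_add_cancel] at h
  exact h.continuousWithinAt

theorem schwinger_dilate (q : ℕ) (τ s : ℝ) {l : ℝ} (hl : 0 < l)
    (f : 𝓢(EuclideanSpace ℝ (Fin d), ℂ)) (t : ℝ) :
    schwinger q τ s (dilate l f) t =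
      ((t ^ (s - 1 - d / 2) : ℝ) : ℂ) * oscIntegral q (τ / (4 * t) * l ^ 2) f := by
  rw [schwinger, oscIntegral_dilate q _ hl]

/-- A continuous size on Schwartz functions that controls the Schwinger integrand. -/
noncomputable def size (q : ℕ) (τ : ℝ) (f : 𝓢(EuclideanSpace ℝ (Fin d), ℂ)) : ℝ :=
  (∫ x, ‖f x‖) + (∫ x, ‖squareMul q f x‖) +
    ‖gaussConst d q τ‖⁻¹ * ∫ p, ‖testFourier d q f p‖

theorem continuous_integral_norm :
    Continuous fun f : 𝓢(EuclideanSpace ℝ (Fin d), ℂ) ↦ ∫ x, ‖f x‖ := by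
  have h : Continuous fun f : 𝓢(EuclideanSpace ℝ (Fin d), ℂ) ↦ ‖f.toLp 1‖ :=
    SchwartzMap.continuous_toLp.norm
  simpa only [SchwartzMap.norm_toLp_one] using h

theorem continuous_size (q : ℕ) (τ : ℝ) :
    Continuous (size q τ : 𝓢(EuclideanSpace ℝ (Fin d), ℂ) → ℝ) := by
  have h := continuous_integral_norm (d := d)
  exact (h.add (h.comp (squareMul q).continuous)).add
    ((h.comp (testFourier d q).continuous).const_mul _)

theorem size_zero (q : ℕ) (τ : ℝ) : size q τ (0 : 𝓢(EuclideanSpace ℝ (Fin d), ℂ)) = 0 := by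
  simp [size]

theorem integral_norm_le_size (q : ℕ) (τ : ℝ) (f : 𝓢(EuclideanSpace ℝ (Fin d), ℂ)) :
    ∫ x, ‖f x‖ ≤ size q τ f := by
  have h2 : 0 ≤ ∫ x, ‖squareMul q f x‖ := by positivity
  have h3 : 0 ≤ ‖gaussConst d q τ‖⁻¹ * ∫ p, ‖testFourier d q f p‖ := by positivity
  rw [size]; linarith

theorem size_nonneg (q : ℕ) (τ : ℝ) (f : 𝓢(EuclideanSpace ℝ (Fin d), ℂ)) : 0 ≤ size q τ f :=
  (integral_nonneg fun _ ↦ norm_nonneg _).trans (integral_norm_le_size q τ f)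

theorem norm_oscIntegral_le_size (q : ℕ) (τ c : ℝ) (f : 𝓢(EuclideanSpace ℝ (Fin d), ℂ)) :
    ‖oscIntegral q c f‖ ≤ size q τ f :=
  (norm_oscIntegral_le q c f).trans (integral_norm_le_size q τ f)

theorem norm_oscIntegral_squareMul_le_size (q : ℕ) (τ c : ℝ)
    (f : 𝓢(EuclideanSpace ℝ (Fin d), ℂ)) : ‖oscIntegral q c (squareMul q f)‖ ≤ size q τ f := by
  refine (norm_oscIntegral_le q c _).trans ?_
  have h2 : 0 ≤ ∫ x, ‖f x‖ := by positivity
  have h3 : 0 ≤ ‖gaussConst d q τ‖⁻¹ * ∫ p, ‖testFourier d q f p‖ := by positivity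
  rw [size]; linarith

theorem norm_oscIntegral_le_rpow_mul_size (q : ℕ) {τ : ℝ} (hτ : τ * τ = 1) {t : ℝ} (ht : 0 < t)
    (f : 𝓢(EuclideanSpace ℝ (Fin d), ℂ)) :
    ‖oscIntegral q (τ / (4 * t)) f‖ ≤ t ^ (d / 2 : ℝ) * size q τ f := by
  refine (norm_oscIntegral_le_rpow q hτ ht f).trans ?_
  gcongr
  have h1 : 0 ≤ ∫ x, ‖f x‖ := by positivity
  have h2 : 0 ≤ ∫ x, ‖squareMul q f x‖ := by positivity
  rw [size]; linarith

/-- Interpolated decay of the oscillatory integral. -/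
theorem norm_oscIntegral_le_rpow_mul_size_of_le (q : ℕ) {τ : ℝ} (hτ : τ * τ = 1) {t θ : ℝ}
    (ht : 0 < t) (hθ0 : 0 ≤ θ) (hθ : θ ≤ d / 2) (f : 𝓢(EuclideanSpace ℝ (Fin d), ℂ)) :
    ‖oscIntegral q (τ / (4 * t)) f‖ ≤ t ^ θ * size q τ f := by
  rcases le_total t 1 with h | h
  · refine (norm_oscIntegral_le_rpow_mul_size q hτ ht f).trans ?_
    exact mul_le_mul_of_nonneg_right (Real.rpow_le_rpow_of_exponent_ge ht h hθ)
      (size_nonneg q τ f)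
  · refine (norm_oscIntegral_le_size q τ _ f).trans ?_
    exact le_mul_of_one_le_left (size_nonneg q τ f) (Real.one_le_rpow h hθ0)

theorem integrableOn_rpow_Ioc {r : ℝ} (hr : -1 < r) :
    IntegrableOn (fun t : ℝ ↦ t ^ r) (Set.Ioc 0 1) :=
  (intervalIntegrable_iff_integrableOn_Ioc_of_le zero_le_one).1
    (intervalIntegral.intervalIntegrable_rpow' hr)

theorem norm_schwinger_dilate_le (q : ℕ) (τ s : ℝ) {l t : ℝ} (hl : 0 < l) (ht : 0 < t)
    (f : 𝓢(EuclideanSpace ℝ (Fin d), ℂ)) :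
    ‖schwinger q τ s (dilate l f) t‖ ≤ size q τ f * t ^ (s - 1 - d / 2) := by
  rw [schwinger_dilate q τ s hl, norm_mul, Complex.norm_real,
    Real.norm_of_nonneg (by positivity), mul_comm]
  exact mul_le_mul_of_nonneg_right (norm_oscIntegral_le_size q τ _ f) (by positivity)

theorem norm_schwinger_le (q : ℕ) (τ s : ℝ) {t : ℝ} (ht : 0 < t)
    (f : 𝓢(EuclideanSpace ℝ (Fin d), ℂ)) :
    ‖schwinger q τ s f t‖ ≤ size q τ f * t ^ (s - 1 - d / 2) := by
  simpa only [dilate_one] using norm_schwinger_dilate_le q τ s one_pos ht f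

/-- Dilation by l replaces t by t/l² in the oscillatory integral, so a gain of t^θ near t = 0 costs
l^(-2θ). The value θ = d/2 gives the full decay at fixed l; a small θ > 0 makes the loss in l
negligible. -/
theorem norm_schwinger_dilate_le_of_le (q : ℕ) {τ : ℝ} (hτ : τ * τ = 1) (s : ℝ) {l t θ : ℝ}
    (hl : 0 < l) (ht : 0 < t) (hθ0 : 0 ≤ θ) (hθ : θ ≤ d / 2)
    (f : 𝓢(EuclideanSpace ℝ (Fin d), ℂ)) :
    ‖schwinger q τ s (dilate l f) t‖ ≤
      size q τ f * l ^ (-(2 * θ)) * t ^ (s - 1 - d / 2 + θ) := by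
  rw [schwinger_dilate q τ s hl, norm_mul, Complex.norm_real,
    Real.norm_of_nonneg (by positivity)]
  have h1 : τ / (4 * t) * l ^ 2 = τ / (4 * (t / l ^ 2)) := by field_simp
  have h2 : (t / l ^ 2) ^ θ = t ^ θ * l ^ (-(2 * θ)) := by
    rw [Real.div_rpow ht.le (by positivity), Real.rpow_neg hl.le, Real.rpow_mul hl.le,
      Real.rpow_two, div_eq_mul_inv]
  have h3 := norm_oscIntegral_le_rpow_mul_size_of_le q hτ (t := t / l ^ 2) (by positivity)
    hθ0 hθ f
  rw [h1, Real.rpow_add ht]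
  rw [h2] at h3
  refine (mul_le_mul_of_nonneg_left h3 (by positivity)).trans_eq (by ring)

theorem norm_schwinger_le_of_small (q : ℕ) {τ : ℝ} (hτ : τ * τ = 1) (s : ℝ) {t : ℝ}
    (ht : 0 < t) (f : 𝓢(EuclideanSpace ℝ (Fin d), ℂ)) :
    ‖schwinger q τ s f t‖ ≤ size q τ f * t ^ (s - 1) := by
  have h := norm_schwinger_dilate_le_of_le q hτ s one_pos ht (θ := d / 2) (by positivity) le_rfl f
  simpa only [dilate_one, Real.one_rpow, mul_one, sub_add_cancel] using h

theorem abs_eq_one_of_mul_self {r : ℝ} (h : r * r = 1) : |r| = 1 := by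
  have : |r| * |r| = 1 := by rw [← abs_mul, h, abs_one]
  nlinarith [abs_nonneg r]

/-- Of the two terms of `oscIntegral_eulerShift` the second carries c = τl²/(4t) and thus gains a
factor 1/t, uniformly for l ≤ 1; the first carries s - d/2. At s = d/2 only the faster decay
remains. -/
theorem norm_schwinger_eulerShift_dilate_le (q : ℕ) {τ : ℝ} (hτ : τ * τ = 1) (s : ℝ) {l t : ℝ}
    (hl : 0 < l) (hl1 : l ≤ 1) (ht : 0 < t) (f : 𝓢(EuclideanSpace ℝ (Fin d), ℂ)) :
    ‖schwinger q τ s (eulerShift s (dilate l f)) t‖ ≤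
      size q τ f * (|s - d / 2| * t ^ (s - 1 - d / 2) + t ^ (s - 2 - d / 2)) := by
  have hτ1 : |τ| = 1 := abs_eq_one_of_mul_self hτ
  rw [eulerShift_dilate s hl.ne', schwinger_dilate q τ s hl, oscIntegral_eulerShift, norm_mul,
    Complex.norm_real, Real.norm_of_nonneg (by positivity)]
  have hS := size_nonneg q τ f
  have h1 : ‖((s - d / 2 : ℝ) : ℂ) * oscIntegral q (τ / (4 * t) * l ^ 2) f‖ ≤
      |s - d / 2| * size q τ f := by
    rw [norm_mul, Complex.norm_real, Real.norm_eq_abs]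
    exact mul_le_mul_of_nonneg_left (norm_oscIntegral_le_size q τ _ f) (abs_nonneg _)
  have h2 : ‖((τ / (4 * t) * l ^ 2 : ℝ) : ℂ) * (Complex.I *
      oscIntegral q (τ / (4 * t) * l ^ 2) (squareMul q f))‖ ≤ t⁻¹ * size q τ f := by
    rw [norm_mul, norm_mul, Complex.norm_I, one_mul, Complex.norm_real, Real.norm_eq_abs, abs_mul,
      abs_div, hτ1, abs_of_pos (by positivity), abs_of_pos (by positivity : 0 < l ^ 2)]
    refine mul_le_mul ?_ (norm_oscIntegral_squareMul_le_size q τ _ f) (norm_nonneg _)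
      (by positivity)
    rw [div_mul_eq_mul_div, one_mul, inv_eq_one_div]
    gcongr
    · nlinarith
    · linarith
  have hp : t ^ (s - 2 - d / 2) = t ^ (s - 1 - d / 2) * t⁻¹ := by
    rw [← Real.rpow_neg_one t, ← Real.rpow_add ht]; congr 1; ring
  rw [hp]
  refine (mul_le_mul_of_nonneg_left ((norm_sub_le _ _).trans (add_le_add h1 h2))
    (by positivity)).trans_eq (by ring)

theorem integrableOn_eulerShift_bound {s : ℝ} (hs : s ≤ d / 2) :
    IntegrableOn (fun t : ℝ ↦ |s - d / 2| * t ^ (s - 1 - d / 2) + t ^ (s - 2 - d / 2))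
      (Set.Ioi 1) := by
  refine Integrable.add ?_ (integrableOn_Ioi_rpow_of_lt (by linarith) one_pos)
  -- At s = d/2 the term t^(-1), not integrable at infinity, has coefficient zero. This is why the
  -- regularization reaches s = d/2 + 1 inclusively.
  rcases hs.eq_or_lt with h | h
  · simp [h]
  · exact (integrableOn_Ioi_rpow_of_lt (by linarith) one_pos).const_mul _

/-- The boundary value of the Schwinger integral for `0 < s ≤ d/2 + 1`. -/
noncomputable def schwingerReg (q : ℕ) (τ s : ℝ) (f : 𝓢(EuclideanSpace ℝ (Fin d), ℂ)) (z : ℂ) :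
    ℂ :=
  laplaceReg (schwinger q τ s f) (schwinger q τ (s - 1) (eulerShift (s - 1) f)) z

theorem hasDerivAt_schwinger' (q : ℕ) (τ s : ℝ) (f : 𝓢(EuclideanSpace ℝ (Fin d), ℂ)) {t : ℝ}
    (ht : 0 < t) :
    HasDerivAt (schwinger q τ s f) (schwinger q τ (s - 1) (eulerShift (s - 1) f) t) t := by
  have h := hasDerivAt_schwinger q τ (s - 1) f ht
  rwa [sub_add_cancel] at h

theorem integral_schwinger_eq_reg (q : ℕ) {τ : ℝ} (hτ : τ * τ = 1) {s : ℝ} (hs : 0 < s)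
    (hs' : s ≤ d / 2 + 1) (f : 𝓢(EuclideanSpace ℝ (Fin d), ℂ)) {z : ℂ} (hz : 0 < z.re) :
    ∫ t in Set.Ioi 0, schwinger q τ s f t * Complex.exp (-(z * t)) = schwingerReg q τ s f z := by
  refine integral_mul_cexp_eq_laplaceReg (C := size q τ f) hz
    (fun t ht ↦ hasDerivAt_schwinger' q τ s f ht) (fun t ht ↦ ?_) ?_ ?_
  · have ht' : (1 : ℝ) < t := ht
    refine (norm_schwinger_le q τ s (zero_lt_one.trans ht') f).trans ?_
    exact mul_le_of_le_one_right (size_nonneg q τ f)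
      (Real.rpow_le_one_of_one_le_of_nonpos ht'.le (by linarith))
  · refine Integrable.mono' ((integrableOn_rpow_Ioc (r := s - 1) (by linarith)).const_mul
      (size q τ f)) (((continuousOn_schwinger q τ s f).mono
        Set.Ioc_subset_Ioi_self).aestronglyMeasurable measurableSet_Ioc) ?_
    filter_upwards [ae_restrict_mem measurableSet_Ioc] with t ht
    exact norm_schwinger_le_of_small q hτ s ht.1 f
  · refine Integrable.mono' ((integrableOn_eulerShift_bound (d := d) (s := s - 1)
      (by linarith)).const_mul (size q τ f)) (((continuousOn_schwinger q τ _ _).mono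
        (Set.Ioi_subset_Ioi zero_le_one)).aestronglyMeasurable measurableSet_Ioi) ?_
    filter_upwards [ae_restrict_mem measurableSet_Ioi] with t ht
    have ht' : (1 : ℝ) < t := ht
    have h := norm_schwinger_eulerShift_dilate_le q hτ (s - 1) one_pos le_rfl
      (zero_lt_one.trans ht') f
    rwa [dilate_one] at h

/-! ### Boundary values at a nonzero rate and their scaling -/

theorem tendsto_rate (y : ℝ) :
    Tendsto (fun ε : ℝ ↦ (ε : ℂ) + Complex.I * (y : ℂ)) (𝓝[>] 0) (𝓝 (Complex.I * y)) := by
  have : Continuous fun ε : ℝ ↦ (ε : ℂ) + Complex.I * (y : ℂ) := by fun_prop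
  have h := (this.tendsto 0).mono_left (nhdsWithin_le_nhds (s := Set.Ioi 0))
  simpa using h

theorem tendsto_schwingerReg (q : ℕ) {τ : ℝ} (hτ : τ * τ = 1) {s : ℝ} (hs : 0 < s)
    (hs' : s ≤ d / 2 + 1) (f : 𝓢(EuclideanSpace ℝ (Fin d), ℂ)) {y : ℝ} (hy : y ≠ 0) :
    Tendsto (fun ε : ℝ ↦ ∫ t in Set.Ioi 0, schwinger q τ s f t *
      Complex.exp (-(((ε : ℂ) + Complex.I * (y : ℂ)) * t))) (𝓝[>] 0)
      (𝓝 (schwingerReg q τ s f (Complex.I * y))) := by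
  have hpos : ∀ᶠ ε : ℝ in 𝓝[>] 0, 0 < ε := self_mem_nhdsWithin
  have h := tendsto_laplaceReg (l := 𝓝[>] (0 : ℝ)) (v := fun _ ↦ schwinger q τ s f)
    (w := fun _ ↦ schwinger q τ (s - 1) (eulerShift (s - 1) f))
    (z := fun ε ↦ (ε : ℂ) + Complex.I * (y : ℂ)) (z₀ := Complex.I * y)
    (b := fun t ↦ size q τ f * t ^ (s - 1))
    (b' := fun t ↦ size q τ f * (|s - 1 - d / 2| * t ^ (s - 1 - 1 - d / 2) +
      t ^ (s - 1 - 2 - d / 2)))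
    (hpos.mono fun ε hε ↦ by rw [re_add_I_mul]; exact hε.le) (tendsto_rate y) (by simp [hy])
    (.of_forall fun _ ↦ continuousOn_schwinger q τ _ _)
    (.of_forall fun _ ↦ continuousOn_schwinger q τ _ _)
    (.of_forall fun _ t ht ↦ norm_schwinger_le_of_small q hτ s ht.1 f)
    ((integrableOn_rpow_Ioc (by linarith)).const_mul _)
    (.of_forall fun _ t ht ↦ by
      have h := norm_schwinger_eulerShift_dilate_le q hτ (s - 1) one_pos le_rfl
        (zero_lt_one.trans ht) f
      rwa [dilate_one] at h)
    ((integrableOn_eulerShift_bound (by linarith)).const_mul _)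
    (fun _ _ ↦ tendsto_const_nhds) (fun _ _ ↦ tendsto_const_nhds)
  refine h.congr' ?_
  filter_upwards [hpos] with ε hε
  exact (integral_schwinger_eq_reg q hτ hs hs' f (by rwa [re_add_I_mul])).symm

/-- The exponent θ only has to make t^(s-1-d/2+θ) integrable at 0. With θ = d/2 and l = 1 this
yields continuity in f; with θ close to 0 it controls the critical index s = d/2. -/
theorem norm_schwingerReg_dilate_le (q : ℕ) {τ : ℝ} (hτ : τ * τ = 1) {s θ : ℝ}
    (hs' : s ≤ d / 2 + 1) (hθ0 : 0 ≤ θ) (hθ : θ ≤ d / 2) (hsθ : 0 < s - d / 2 + θ) (y : ℝ) :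
    ∃ C, ∀ (l : ℝ), 0 < l → l ≤ 1 → ∀ f : 𝓢(EuclideanSpace ℝ (Fin d), ℂ),
      ‖schwingerReg q τ s (dilate l f) (Complex.I * y)‖ ≤ C * l ^ (-(2 * θ)) * size q τ f := by
  refine ⟨(∫ t in Set.Ioc (0 : ℝ) 1, t ^ (s - 1 - d / 2 + θ)) +
    (1 + ∫ t in Set.Ioi (1 : ℝ), (|s - 1 - d / 2| * t ^ (s - 1 - 1 - d / 2) +
      t ^ (s - 1 - 2 - d / 2))) / ‖Complex.I * y‖, fun l hl hl1 f ↦ ?_⟩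
  -- The boundary term at 1 and the integral over (1, ∞) cost no power of l; as l ≤ 1, the factor
  -- l^(-2θ) may be inserted there.
  have hll : 1 ≤ l ^ (-(2 * θ)) :=
    Real.one_le_rpow_of_pos_of_le_one_of_nonpos hl hl1 (by linarith)
  have hS := size_nonneg q τ f
  refine (norm_laplaceReg_le (b := fun t ↦ size q τ f * l ^ (-(2 * θ)) * t ^ (s - 1 - d / 2 + θ))
    (c := size q τ f * l ^ (-(2 * θ)) * 1)
    (b' := fun t ↦ size q τ f * l ^ (-(2 * θ)) * (|s - 1 - d / 2| * t ^ (s - 1 - 1 - d / 2) +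
      t ^ (s - 1 - 2 - d / 2))) (by simp)
    (fun t ht ↦ norm_schwinger_dilate_le_of_le q hτ s hl ht.1 hθ0 hθ f)
    ((integrableOn_rpow_Ioc (by linarith)).const_mul _) ?_ (fun t ht ↦ ?_)
    ((integrableOn_eulerShift_bound (by linarith)).const_mul _)).trans_eq ?_
  · simpa using norm_schwinger_dilate_le_of_le q hτ s hl one_pos hθ0 hθ f
  · have ht0 : (0 : ℝ) < t := zero_lt_one.trans ht
    refine (norm_schwinger_eulerShift_dilate_le q hτ (s - 1) hl hl1 ht0 f).trans ?_
    exact mul_le_mul_of_nonneg_right (le_mul_of_one_le_right hS hll) (by positivity)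
  · rw [integral_const_mul, integral_const_mul]
    ring

theorem tendsto_mul_sq (c : ℝ) : Tendsto (fun l : ℝ ↦ c * l ^ 2) (𝓝[>] 0) (𝓝 0) := by
  have : Continuous fun l : ℝ ↦ c * l ^ 2 := by fun_prop
  have h := (this.tendsto 0).mono_left (nhdsWithin_le_nhds (s := Set.Ioi 0))
  simpa using h

/-- In the dilated integrand c is multiplied by l², so the phase flattens to 1. -/
theorem tendsto_schwinger_dilate (q : ℕ) (τ s : ℝ) (f : 𝓢(EuclideanSpace ℝ (Fin d), ℂ)) (t : ℝ) :
    Tendsto (fun l ↦ schwinger q τ s (dilate l f) t) (𝓝[>] 0)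
      (𝓝 (((t ^ (s - 1 - d / 2) : ℝ) : ℂ) * ∫ x, f x)) := by
  have h : Tendsto (fun l : ℝ ↦ oscIntegral q (τ / (4 * t) * l ^ 2) f) (𝓝[>] 0)
      (𝓝 (∫ x, f x)) := by
    rw [← oscIntegral_zero q]
    exact ((continuous_oscIntegral q f).tendsto 0).comp (tendsto_mul_sq _)
  refine (h.const_mul _).congr' ?_
  filter_upwards [self_mem_nhdsWithin] with l hl
  rw [schwinger_dilate q τ s hl]

/-- The value at the origin of a Bessel potential of index `s > d/2`. -/
theorem tendsto_schwingerReg_dilate (q : ℕ) {τ : ℝ} (hτ : τ * τ = 1) {s : ℝ} (hs : d / 2 < s)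
    (hs' : s ≤ d / 2 + 1) {y : ℝ} (hy : y ≠ 0) (f : 𝓢(EuclideanSpace ℝ (Fin d), ℂ)) :
    Tendsto (fun l ↦ schwingerReg q τ s (dilate l f) (Complex.I * y)) (𝓝[>] 0)
      (𝓝 (Complex.Gamma (s - d / 2 : ℝ) * (Complex.I * y) ^ (-((s - d / 2 : ℝ) : ℂ)) *
        ∫ x, f x)) := by
  have hpos : ∀ᶠ l : ℝ in 𝓝[>] 0, 0 < l := self_mem_nhdsWithin
  have hone : ∀ᶠ l : ℝ in 𝓝[>] 0, l ≤ 1 := by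
    filter_upwards [mem_nhdsWithin_of_mem_nhds (Iic_mem_nhds (zero_lt_one (α := ℝ)))] with l hl
    exact hl
  -- The limiting functions are ∫ f times t^(a-1) and its derivative, where a = s - d/2 lies in (0,
  -- 1]; `laplaceReg_rpow` evaluates their transform. Since a > 0, the bound uniform in l is
  -- integrable at t = 0.
  have h := tendsto_laplaceReg (l := 𝓝[>] (0 : ℝ)) (v := fun l ↦ schwinger q τ s (dilate l f))
    (w := fun l ↦ schwinger q τ (s - 1) (eulerShift (s - 1) (dilate l f)))
    (v₀ := fun t ↦ (∫ x, f x) * ((t ^ (s - d / 2 - 1) : ℝ) : ℂ))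
    (w₀ := fun t ↦ (∫ x, f x) * (((s - d / 2 - 1) * t ^ (s - d / 2 - 2) : ℝ) : ℂ))
    (z := fun _ ↦ Complex.I * y) (z₀ := Complex.I * y)
    (b := fun t ↦ size q τ f * t ^ (s - 1 - d / 2))
    (b' := fun t ↦ size q τ f * (|s - 1 - d / 2| * t ^ (s - 1 - 1 - d / 2) +
      t ^ (s - 1 - 2 - d / 2)))
    (.of_forall fun _ ↦ by simp) tendsto_const_nhds (by simp [hy])
    (.of_forall fun _ ↦ continuousOn_schwinger q τ _ _)
    (.of_forall fun _ ↦ continuousOn_schwinger q τ _ _)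
    (hpos.mono fun l hl t ht ↦ norm_schwinger_dilate_le q τ s hl ht.1 f)
    ((integrableOn_rpow_Ioc (by linarith)).const_mul _)
    ((hpos.and hone).mono fun l hl t ht ↦
      norm_schwinger_eulerShift_dilate_le q hτ (s - 1) hl.1 hl.2 (zero_lt_one.trans ht) f)
    ((integrableOn_eulerShift_bound (by linarith)).const_mul _)
    (fun t _ ↦ by
      have h := tendsto_schwinger_dilate q τ s f t
      rwa [mul_comm, show s - 1 - (d : ℝ) / 2 = s - d / 2 - 1 by ring] at h)
    (fun t _ ↦ by
      have h := tendsto_schwinger_dilate q τ (s - 1) (eulerShift (s - 1) f) t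
      rw [integral_eulerShift] at h
      refine (h.congr' ?_).trans_eq ?_
      · filter_upwards [hpos] with l hl
        rw [eulerShift_dilate _ hl.ne']
      · rw [show s - 1 - 1 - (d : ℝ) / 2 = s - d / 2 - 2 by ring]
        push_cast
        ring_nf)
  rw [laplaceReg_const_mul, laplaceReg_rpow (by linarith) (by linarith) hy,
    mul_comm (∫ x, f x)] at h
  exact h

/-- Integration by parts lowers the index of the Schwinger integral. -/
theorem integral_schwinger_add_one (q : ℕ) {τ : ℝ} (hτ : τ * τ = 1) {s : ℝ} (hs : 0 < s)
    (f : 𝓢(EuclideanSpace ℝ (Fin d), ℂ)) {z : ℂ} (hz : 0 < z.re) :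
    ∫ t in Set.Ioi 0, schwinger q τ (s + 1) f t * Complex.exp (-(z * t)) =
      (∫ t in Set.Ioi 0, schwinger q τ s (eulerShift s f) t * Complex.exp (-(z * t))) / z := by
  have hint : ∀ {r : ℝ}, 0 < r → ∀ g : 𝓢(EuclideanSpace ℝ (Fin d), ℂ),
      IntegrableOn (fun t ↦ schwinger q τ r g t * Complex.exp (-(z * t))) (Set.Ioi 0) := by
    intro r hr g
    have h0 : IntegrableOn (fun t : ℝ ↦ t ^ (r - 1) * Real.exp (-z.re * t)) (Set.Ioi 0) := by
      simpa using integrableOn_rpow_mul_exp_neg_mul_rpow (s := r - 1) (by linarith) one_pos hz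
    refine Integrable.mono' (h0.const_mul (size q τ g))
      (((continuousOn_schwinger q τ _ _).aestronglyMeasurable measurableSet_Ioi).mul
        (by fun_prop)) ?_
    filter_upwards [ae_restrict_mem measurableSet_Ioi] with t ht
    rw [norm_mul, Complex.norm_exp, Complex.neg_re, Complex.re_mul_ofReal, ← mul_assoc, neg_mul]
    exact mul_le_mul_of_nonneg_right (norm_schwinger_le_of_small q hτ r ht g) (Real.exp_pos _).le
  have h := integral_Ioi_mul_cexp_eq_div (v₀ := 0) (C := size q τ f) (a := 0) (r := s) hz
    (fun t ht ↦ hasDerivAt_schwinger q τ s f ht) (fun t ht ↦ by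
      have ht' : 0 < t := lt_of_le_of_lt (le_max_left _ _) ht
      simpa using norm_schwinger_le_of_small q hτ (s + 1) ht' f) (hint (by linarith) f)
    -- The boundary term at 0 vanishes because the integrand of index s + 1 is O(t^s).
    (hint hs _) (by
      have h0 : Tendsto (fun t : ℝ ↦ size q τ f * t ^ s) (𝓝[>] 0) (𝓝 0) := by
        have := (Real.continuousAt_rpow_const 0 s (Or.inr hs.le)).tendsto.mono_left
          (nhdsWithin_le_nhds (s := Set.Ioi 0))
        rw [Real.zero_rpow hs.ne'] at this
        simpa using this.const_mul (size q τ f)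
      refine squeeze_zero_norm' ?_ h0
      filter_upwards [self_mem_nhdsWithin] with t ht
      simpa using norm_schwinger_le_of_small q hτ (s + 1) ht f)
  simpa using h

/-- Existence and scaling of the boundary value of the Schwinger integral at a nonzero rate. -/
theorem exists_schwinger_limit (q : ℕ) {τ : ℝ} (hτ : τ * τ = 1) {y : ℝ} (hy : y ≠ 0) (n : ℕ) :
    ∀ s : ℝ, 0 < s → s ≤ d / 2 + 1 + n →
      ∃ (L : 𝓢(EuclideanSpace ℝ (Fin d), ℂ) → ℂ) (N : 𝓢(EuclideanSpace ℝ (Fin d), ℂ) → ℝ),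
        (∀ f, Tendsto (fun ε : ℝ ↦ ∫ t in Set.Ioi 0, schwinger q τ s f t *
          Complex.exp (-(((ε : ℂ) + Complex.I * (y : ℂ)) * t))) (𝓝[>] 0) (𝓝 (L f))) ∧
        Continuous N ∧ N 0 = 0 ∧ (∀ f, ‖L f‖ ≤ N f) ∧
        (d / 2 < s → ∃ c : ℂ, c ≠ 0 ∧
          ∀ f, Tendsto (fun l ↦ L (dilate l f)) (𝓝[>] 0) (𝓝 (c * ∫ x, f x))) := by
  -- The regularized integral covers s ≤ d/2 + 1; each step raises the bound by one through
  -- `integral_schwinger_add_one`. The constant c acquires the factor (s - 1 - d/2)/(iy), nonzero as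
  -- s - 1 > d/2 in the new range. N is a continuous majorant vanishing at 0, carried along to make
  -- the limit continuous in f.
  induction n with
  | zero =>
    intro s hs hs'
    have hs'' : s ≤ d / 2 + 1 := by simpa using hs'
    obtain ⟨C, hC⟩ := norm_schwingerReg_dilate_le (d := d) q hτ (s := s) (θ := d / 2) hs''
      (by positivity) le_rfl (by simpa using hs) y
    refine ⟨fun f ↦ schwingerReg q τ s f (Complex.I * y), fun f ↦ C * size q τ f,
      fun f ↦ tendsto_schwingerReg q hτ hs hs'' f hy, (continuous_size q τ).const_mul C,
      by simp [size_zero], fun f ↦ ?_, fun hds ↦ ⟨_, ?_,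
        fun f ↦ tendsto_schwingerReg_dilate q hτ hds hs'' hy f⟩⟩
    · simpa [dilate_one] using hC 1 one_pos le_rfl f
    · refine mul_ne_zero (Complex.Gamma_ne_zero_of_re_pos (by simpa using hds)) ?_
      rw [Complex.cpow_ne_zero_iff]
      left
      simp [hy]
  | succ n ih =>
    intro s hs hs'
    rcases le_or_gt s (d / 2 + 1 + n) with h | h
    · exact ih s hs h
    have hd : (0 : ℝ) ≤ d / 2 := by positivity
    have hn : (0 : ℝ) ≤ n := by positivity
    push_cast at hs'
    obtain ⟨L, N, hL, hN, hN0, hLN, hc⟩ := ih (s - 1) (by linarith) (by linarith)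
    obtain ⟨c, hc0, hc⟩ := hc (by linarith)
    have hy0 : Complex.I * (y : ℂ) ≠ 0 := by simp [hy]
    refine ⟨fun f ↦ L (eulerShift (s - 1) f) / (Complex.I * y),
      fun f ↦ N (eulerShift (s - 1) f) / ‖Complex.I * (y : ℂ)‖, fun f ↦ ?_,
      (hN.comp (eulerShift (s - 1)).continuous).div_const _, by simp [hN0], fun f ↦ ?_,
      fun _ ↦ ⟨c * ((s - 1 - d / 2 : ℝ) : ℂ) / (Complex.I * y), ?_, fun f ↦ ?_⟩⟩
    · refine ((hL (eulerShift (s - 1) f)).div (tendsto_rate y) hy0).congr' ?_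
      filter_upwards [self_mem_nhdsWithin] with ε hε
      have h := integral_schwinger_add_one q hτ (s := s - 1) (by linarith) f
        (z := (ε : ℂ) + Complex.I * (y : ℂ)) (by rw [re_add_I_mul]; exact hε)
      rw [sub_add_cancel] at h
      exact h.symm
    · rw [norm_div]
      exact div_le_div_of_nonneg_right (hLN _) (norm_nonneg _)
    · refine div_ne_zero (mul_ne_zero hc0 ?_) hy0
      rw [Complex.ofReal_ne_zero]
      linarith
    · have h := (hc (eulerShift (s - 1) f)).div_const (Complex.I * (y : ℂ))
      rw [integral_eulerShift] at h
      refine (h.congr' ?_).trans_eq (by congr 1; ring)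
      filter_upwards [self_mem_nhdsWithin] with l hl
      rw [eulerShift_dilate _ (ne_of_gt hl)]

/-! ### Small index: absolutely convergent Schwinger integrals -/

/-- A common integrable bound for the Schwinger integrand when `0 < s < d/2`. -/
theorem exists_bound_schwinger (q : ℕ) {τ : ℝ} (hτ : τ * τ = 1) {s : ℝ} (hs : 0 < s)
    (hs' : s < d / 2) : ∃ b : ℝ → ℝ, IntegrableOn b (Set.Ioi 0) ∧
      ∀ (f : 𝓢(EuclideanSpace ℝ (Fin d), ℂ)), ∀ t ∈ Set.Ioi (0 : ℝ),
        ‖schwinger q τ s f t‖ ≤ size q τ f * b t := by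
  classical
  refine ⟨fun t ↦ if t ≤ 1 then t ^ (s - 1) else t ^ (s - 1 - d / 2), ?_, fun f t ht ↦ ?_⟩
  · rw [← Set.Ioc_union_Ioi_eq_Ioi zero_le_one]
    refine IntegrableOn.union ?_ ?_
    · exact (integrableOn_rpow_Ioc (r := s - 1) (by linarith)).congr_fun
        (fun t ht ↦ (if_pos ht.2).symm) measurableSet_Ioc
    · exact (integrableOn_Ioi_rpow_of_lt (a := s - 1 - d / 2) (by linarith) one_pos).congr_fun
        (fun t ht ↦ (if_neg (not_le.2 ht)).symm) measurableSet_Ioi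
  · dsimp only
    split_ifs
    · exact norm_schwinger_le_of_small q hτ s ht f
    · exact norm_schwinger_le q τ s ht f

theorem tendsto_integral_schwinger (q : ℕ) {τ : ℝ} (hτ : τ * τ = 1) {s : ℝ} (hs : 0 < s)
    (hs' : s < d / 2) (f : 𝓢(EuclideanSpace ℝ (Fin d), ℂ)) {ι : Type*} {l : Filter ι}
    [l.IsCountablyGenerated] {z : ι → ℂ} {z₀ : ℂ} (hz : ∀ᶠ i in l, 0 ≤ (z i).re)
    (hzt : Tendsto z l (𝓝 z₀)) :
    Tendsto (fun i ↦ ∫ t in Set.Ioi 0, schwinger q τ s f t * Complex.exp (-(z i * t))) l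
      (𝓝 (∫ t in Set.Ioi 0, schwinger q τ s f t * Complex.exp (-(z₀ * t)))) := by
  obtain ⟨b, hb, hfb⟩ := exists_bound_schwinger q hτ hs hs'
  exact tendsto_integral_mul_cexp (v := fun _ ↦ schwinger q τ s f) measurableSet_Ioi
    subset_rfl hz hzt (.of_forall fun _ ↦ continuousOn_schwinger q τ s f)
    (.of_forall fun _ ↦ hfb f) (hb.const_mul _) fun _ _ ↦ tendsto_const_nhds

theorem exists_norm_integral_schwinger_le (q : ℕ) {τ : ℝ} (hτ : τ * τ = 1) {s : ℝ} (hs : 0 < s)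
    (hs' : s < d / 2) : ∃ C : ℝ, ∀ (f : 𝓢(EuclideanSpace ℝ (Fin d), ℂ)) (z : ℂ), 0 ≤ z.re →
      ‖∫ t in Set.Ioi 0, schwinger q τ s f t * Complex.exp (-(z * t))‖ ≤ C * size q τ f := by
  obtain ⟨b, hb, hfb⟩ := exists_bound_schwinger q hτ hs hs'
  refine ⟨∫ t in Set.Ioi 0, b t, fun f z hz ↦ ?_⟩
  refine (norm_integral_mul_cexp_le hz measurableSet_Ioi subset_rfl (hfb f)
    (hb.const_mul _)).trans_eq ?_
  rw [integral_const_mul, mul_comm]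

/-- Substitute t ↦ l²t: the phase of the dilated integrand becomes the original one, the powers of
l² combine to l^(2s-d), and the rate is multiplied by l². -/
theorem integral_schwinger_dilate (q : ℕ) (τ s : ℝ) {l : ℝ} (hl : 0 < l)
    (f : 𝓢(EuclideanSpace ℝ (Fin d), ℂ)) (z : ℂ) :
    ∫ t in Set.Ioi 0, schwinger q τ s (dilate l f) t * Complex.exp (-(z * t)) =
      ((l ^ (2 * s - d) : ℝ) : ℂ) * ∫ t in Set.Ioi 0, schwinger q τ s f t *
        Complex.exp (-((z * ((l ^ 2 : ℝ) : ℂ)) * t)) := by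
  have hl2 : 0 < l ^ 2 := by positivity
  have h := integral_comp_mul_left_Ioi
    (fun t ↦ schwinger q τ s (dilate l f) t * Complex.exp (-(z * t))) 0 hl2
  rw [mul_zero] at h
  have h2 : ∀ t ∈ Set.Ioi (0 : ℝ), schwinger q τ s (dilate l f) (l ^ 2 * t) *
      Complex.exp (-(z * ((l ^ 2 * t : ℝ) : ℂ))) =
      (((l ^ 2) ^ (s - 1 - d / 2) : ℝ) : ℂ) * (schwinger q τ s f t *
        Complex.exp (-((z * ((l ^ 2 : ℝ) : ℂ)) * t))) := fun t ht ↦ by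
    have ht' : 0 < t := ht
    rw [schwinger_dilate q τ s hl, schwinger, Real.mul_rpow hl2.le ht'.le,
      show τ / (4 * (l ^ 2 * t)) * l ^ 2 = τ / (4 * t) by field_simp]
    push_cast
    ring_nf
  rw [setIntegral_congr_fun measurableSet_Ioi h2, integral_const_mul, eq_comm,
    inv_smul_eq_iff₀ hl2.ne', Complex.real_smul, ← mul_assoc, ← Complex.ofReal_mul] at h
  have hpow : l ^ 2 * (l ^ 2) ^ (s - 1 - d / 2) = l ^ (2 * s - d) := by
    rw [← Real.rpow_two, ← Real.rpow_mul hl.le, ← Real.rpow_add hl]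
    congr 1; ring
  rw [h, hpow]

/-! ### Nonvanishing of the massless potential -/

theorem integral_rpow_mul_cexp_neg_div {b : ℝ} (hb : 0 < b) {w : ℂ} (hw : 0 < w.re) :
    ∫ t in Set.Ioi (0 : ℝ), ((t ^ (-b - 1) : ℝ) : ℂ) * Complex.exp (-(w / t)) =
      Complex.Gamma b * w ^ (-b : ℂ) := by
  -- This is the Gamma integral after t ↦ 1/t.
  rw [← integral_rpow_mul_cexp_neg_mul hb hw, ← integral_comp_rpow_Ioi _ (p := -1) (by norm_num)]
  refine setIntegral_congr_fun measurableSet_Ioi fun t ht ↦ ?_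
  have ht' : 0 < t := ht
  simp only [abs_neg, abs_one, one_mul, Real.rpow_neg_one, Complex.real_smul]
  rw [← mul_assoc, ← Complex.ofReal_mul, Real.inv_rpow ht'.le, ← Real.rpow_neg ht'.le,
    ← Real.rpow_add ht']
  congr 2
  · rw [show -1 - 1 + -(-b - 1) = b - 1 by ring]
  · push_cast; rw [div_inv_eq_mul]

theorem exists_bump {E : Type*} [NormedAddCommGroup E] [NormedSpace ℝ E] [FiniteDimensional ℝ E]
    {U : Set E} {x₀ : E} (hU : U ∈ 𝓝 x₀) :
    ∃ φ : 𝓓((⊤ : Opens E), ℝ), (∀ x, 0 ≤ φ x) ∧ φ x₀ = 1 ∧ ∀ x, φ x ≠ 0 → x ∈ U := by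
  obtain ⟨f, h1, h2, h3, h4, h5⟩ := exists_contDiff_tsupport_subset (n := ⊤) hU
  refine ⟨⟨f, h3, h2, fun _ _ ↦ trivial⟩, fun x ↦ (h4 ⟨x, rfl⟩).1, h5,
    fun x hx ↦ h1 (subset_tsupport f hx)⟩

/-- The factor exp(-ε/t) makes the double integral over x and t absolutely convergent. Integrating
in t first exhibits the massless potential as the boundary value of a power of ε - iτx²/4. -/
theorem integral_schwinger_eq_limit (q : ℕ) {τ : ℝ} {s : ℝ} (hs' : s < d / 2)
    (f : 𝓢(EuclideanSpace ℝ (Fin d), ℂ)) {ε : ℝ} (hε : 0 < ε) :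
    ∫ t in Set.Ioi 0, schwinger q τ s f t * Complex.exp (-((ε : ℂ) / t)) =
      Complex.Gamma (d / 2 - s : ℝ) * ∫ x, f x *
        ((ε : ℂ) + Complex.I * (-(τ / 4 * pseudoInner q x x) : ℝ)) ^ (-((d / 2 - s : ℝ) : ℂ)) := by
  have hb : 0 < d / 2 - s := by linarith
  have hint : IntegrableOn (fun t : ℝ ↦ ((t ^ (-(d / 2 - s) - 1) : ℝ) : ℂ) *
      Complex.exp (-((ε : ℂ) / t))) (Set.Ioi 0) := by
    -- A non-integrable function has integral 0 by convention, whereas Γ(b) ε^(-b) is not zero.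
    by_contra h
    have h1 := integral_rpow_mul_cexp_neg_div hb (w := (ε : ℂ)) (by simpa using hε)
    rw [integral_undef h] at h1
    refine mul_ne_zero (Complex.Gamma_ne_zero_of_re_pos (by simpa using hb)) ?_ h1.symm
    rw [Complex.cpow_ne_zero_iff]
    left
    exact_mod_cast hε.ne'
  have hcont := continuous_pseudoInner_self (d := d) q
  have hswap := integral_integral_swap (μ := (volume : Measure (EuclideanSpace ℝ (Fin d))))
    (ν := volume.restrict (Set.Ioi 0))
    (f := fun x t ↦ phase q (τ / (4 * t)) x * (f x * (((t ^ (-(d / 2 - s) - 1) : ℝ) : ℂ) *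
      Complex.exp (-((ε : ℂ) / t))))) (by
      have hph : Measurable fun z : EuclideanSpace ℝ (Fin d) × ℝ ↦
          phase q (τ / (4 * z.2)) z.1 := by
        have h2 : Measurable fun z : EuclideanSpace ℝ (Fin d) × ℝ ↦ pseudoInner q z.1 z.1 :=
          (hcont.comp continuous_fst).measurable
        unfold phase; fun_prop
      exact ((f.integrable (μ := volume)).mul_prod hint).bdd_mul (c := 1)
        hph.aestronglyMeasurable (.of_forall fun z ↦ (norm_phase _ _ _).le))
  have hR : ∀ x, ∫ t in Set.Ioi 0, phase q (τ / (4 * t)) x *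
      (f x * (((t ^ (-(d / 2 - s) - 1) : ℝ) : ℂ) * Complex.exp (-((ε : ℂ) / t)))) =
      Complex.Gamma (d / 2 - s : ℝ) * (f x *
        ((ε : ℂ) + Complex.I * (-(τ / 4 * pseudoInner q x x) : ℝ)) ^
          (-((d / 2 - s : ℝ) : ℂ))) := fun x ↦ by
    have h1 : ∀ t : ℝ, phase q (τ / (4 * t)) x *
      (f x * (((t ^ (-(d / 2 - s) - 1) : ℝ) : ℂ) * Complex.exp (-((ε : ℂ) / t)))) =
      f x * (((t ^ (-(d / 2 - s) - 1) : ℝ) : ℂ) *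
        Complex.exp (-(((ε : ℂ) + Complex.I * (-(τ / 4 * pseudoInner q x x) : ℝ)) / t))) :=
      fun t ↦ by
        have : Complex.exp (-(((ε : ℂ) + Complex.I * (-(τ / 4 * pseudoInner q x x) : ℝ)) / t)) =
            phase q (τ / (4 * t)) x * Complex.exp (-((ε : ℂ) / t)) := by
          rw [phase, ← Complex.exp_add]
          congr 1
          push_cast
          rw [div_eq_mul_inv, div_eq_mul_inv, div_eq_mul_inv, mul_inv]
          ring
        rw [this]; ring
    simp only [h1]
    rw [integral_const_mul, integral_rpow_mul_cexp_neg_div hb (by rwa [re_add_I_mul])]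
    ring
  simp only [hR] at hswap
  rw [integral_const_mul] at hswap
  rw [hswap]
  refine setIntegral_congr_fun measurableSet_Ioi fun t ht ↦ ?_
  have h1 : ∀ x, phase q (τ / (4 * t)) x *
      (f x * (((t ^ (-(d / 2 - s) - 1) : ℝ) : ℂ) * Complex.exp (-((ε : ℂ) / t)))) =
      (((t ^ (-(d / 2 - s) - 1) : ℝ) : ℂ) * Complex.exp (-((ε : ℂ) / t))) *
        (f x * phase q (τ / (4 * t)) x) := fun x ↦ by ring
  simp only [h1]
  rw [integral_const_mul, schwinger, oscIntegral,
    show -((d : ℝ) / 2 - s) - 1 = s - 1 - d / 2 by ring]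
  ring

/-- The massless Bessel potential does not vanish. -/
theorem exists_integral_schwinger_ne_zero (q : ℕ) {τ : ℝ} (hτ : τ * τ = 1) {s : ℝ} (hs : 0 < s)
    (hs' : s < d / 2) : ∃ φ : 𝓓((⊤ : Opens (EuclideanSpace ℝ (Fin d))), ℝ),
      ∫ t in Set.Ioi 0, schwinger q τ s (testToSchwartz φ) t ≠ 0 := by
  have hτ0 : τ ≠ 0 := by rintro rfl; simp at hτ
  have hb : 0 < d / 2 - s := by linarith
  have hd : 0 < d := by
    rcases Nat.eq_zero_or_pos d with rfl | h
    · simp at hs'; linarith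
    · exact h
  have hcont := continuous_pseudoInner_self (d := d) q
  let i₀ : Fin d := ⟨0, hd⟩
  let x₀ : EuclideanSpace ℝ (Fin d) := EuclideanSpace.single i₀ 1
  have hx₀ : pseudoInner q x₀ x₀ = metricSign q i₀ := by
    simp [pseudoInner, x₀]
  generalize hη : metricSign q i₀ = η at hx₀
  have hηη : η * η = 1 := by rw [← hη]; exact metricSign_mul_self q i₀
  -- The bump function lives where ηx² > 1/2, away from the light cone; there the kernel is a
  -- constant phase times a positive function, so nothing can cancel.
  have hU : {x : EuclideanSpace ℝ (Fin d) | 1 / 2 < η * pseudoInner q x x} ∈ 𝓝 x₀ :=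
    (isOpen_lt continuous_const (continuous_const.mul hcont)).mem_nhds (by
      change 1 / 2 < η * pseudoInner q x₀ x₀
      rw [hx₀, hηη]; norm_num)
  obtain ⟨φ, hφ0, hφ1, hφU⟩ := exists_bump hU
  refine ⟨φ, fun hzero ↦ ?_⟩
  set f := testToSchwartz φ with hf
  obtain ⟨b, hbi, hfb⟩ := exists_bound_schwinger q hτ hs hs'
  have hpos : ∀ᶠ ε : ℝ in 𝓝[>] 0, 0 < ε := self_mem_nhdsWithin
  have hofReal : Tendsto (fun ε : ℝ ↦ (ε : ℂ)) (𝓝[>] 0) (𝓝 0) := by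
    have := (Complex.continuous_ofReal.tendsto 0).mono_left (nhdsWithin_le_nhds (s := Set.Ioi 0))
    simpa using this
  -- the regularization in `t`
  have h1 : Tendsto (fun ε : ℝ ↦ ∫ t in Set.Ioi 0, schwinger q τ s f t *
      Complex.exp (-((ε : ℂ) / t))) (𝓝[>] 0) (𝓝 0) := by
    rw [← hzero]
    refine tendsto_integral_filter_of_dominated_convergence (fun t ↦ size q τ f * b t)
      (.of_forall fun ε ↦ ((continuousOn_schwinger q τ s f).aestronglyMeasurable
        measurableSet_Ioi).mul (Measurable.aestronglyMeasurable (by fun_prop))) ?_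
      (hbi.const_mul _) ?_
    · filter_upwards [hpos] with ε hε
      filter_upwards [ae_restrict_mem measurableSet_Ioi] with t ht
      have ht' : 0 < t := ht
      rw [norm_mul]
      refine (mul_le_of_le_one_right (norm_nonneg _) ?_).trans (hfb f t ht)
      rw [Complex.norm_exp, Real.exp_le_one_iff, ← Complex.ofReal_div, Complex.neg_re,
        Complex.ofReal_re, neg_nonpos]
      positivity
    · refine .of_forall fun t ↦ ?_
      have := ((Complex.continuous_exp.tendsto _).comp
        (hofReal.div_const (t : ℂ)).neg).const_mul (schwinger q τ s f t)
      simpa [Function.comp_def] using this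
  -- the limit in `x`
  let r : EuclideanSpace ℝ (Fin d) → ℝ := fun x ↦
    φ x * (max (η * pseudoInner q x x / 4) (1 / 8)) ^ (-(d / 2 - s))
  have h2 : Tendsto (fun ε : ℝ ↦ Complex.Gamma (d / 2 - s : ℝ) * ∫ x, f x *
      ((ε : ℂ) + Complex.I * (-(τ / 4 * pseudoInner q x x) : ℝ)) ^ (-((d / 2 - s : ℝ) : ℂ)))
      (𝓝[>] 0) (𝓝 (Complex.Gamma (d / 2 - s : ℝ) * ∫ x, (r x : ℂ) *
        (-(Complex.I * (τ * η : ℝ))) ^ (-((d / 2 - s : ℝ) : ℂ)))) := by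
    refine Tendsto.const_mul _ ?_
    refine tendsto_integral_filter_of_dominated_convergence
      (fun x ↦ ‖f x‖ * (1 / 8) ^ (-(d / 2 - s))) (.of_forall fun ε ↦
        f.continuous.aestronglyMeasurable.mul (Measurable.aestronglyMeasurable (by
          have := hcont.measurable; fun_prop))) (.of_forall fun ε ↦ .of_forall fun x ↦ ?_)
      (f.integrable.norm.mul_const _) (.of_forall fun x ↦ ?_)
    · rw [norm_mul]
      rcases eq_or_ne (φ x) 0 with hx | hx
      · have : f x = 0 := by rw [hf, testToSchwartz_apply, hx, Complex.ofReal_zero]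
        simp [this]
      refine mul_le_mul_of_nonneg_left ?_ (norm_nonneg _)
      rw [← Complex.ofReal_neg, Complex.norm_cpow_real]
      refine Real.rpow_le_rpow_of_nonpos (by norm_num) ?_ (by linarith)
      refine le_trans ?_ (Complex.abs_im_le_norm _)
      have him : ((ε : ℂ) + Complex.I * (-(τ / 4 * pseudoInner q x x) : ℝ)).im =
        -(τ / 4 * pseudoInner q x x) := by simp
      have h4 : 1 / 2 < |pseudoInner q x x| := by
        have h5 : 1 / 2 < η * pseudoInner q x x := hφU x hx
        refine h5.trans_le ((le_abs_self _).trans_eq ?_)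
        rw [abs_mul, abs_eq_one_of_mul_self hηη, one_mul]
      rw [him, abs_neg, abs_mul, abs_div, abs_eq_one_of_mul_self hτ, abs_of_pos four_pos]
      linarith
    · rcases eq_or_ne (φ x) 0 with hx | hx
      · have : f x = 0 := by rw [hf, testToSchwartz_apply, hx, Complex.ofReal_zero]
        simp [this, r, hx]
      have h5 : 1 / 2 < η * pseudoInner q x x := hφU x hx
      have hmax : max (η * pseudoInner q x x / 4) (1 / 8) = η * pseudoInner q x x / 4 :=
        max_eq_left (by linarith)
      have hne : pseudoInner q x x ≠ 0 := by rintro h; rw [h] at h5; norm_num at h5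
      have hslit : Complex.I * ((-(τ / 4 * pseudoInner q x x) : ℝ) : ℂ) ∈ Complex.slitPlane := by
        refine Complex.mem_slitPlane_iff.2 (Or.inr ?_)
        simp [hτ0, hne]
      have h6 := (((continuousAt_cpow_const (b := -((d / 2 - s : ℝ) : ℂ)) hslit).tendsto.comp
        (tendsto_rate _)).const_mul (f x))
      refine h6.trans_eq ?_
      -- Using η² = 1, split the base into the fixed phase -iτη and the positive number ηx²/4, so
      -- that the power factors.
      have h7 : Complex.I * ((-(τ / 4 * pseudoInner q x x) : ℝ) : ℂ) =
          -(Complex.I * (τ * η : ℝ)) * ((η * pseudoInner q x x / 4 : ℝ) : ℂ) := by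
        have : (η : ℂ) * η = 1 := by exact_mod_cast hηη
        push_cast
        linear_combination (Complex.I * τ * pseudoInner q x x / 4) * this
      have hη0 : η ≠ 0 := by rintro rfl; simp at hηη
      rw [h7, mul_cpow_of_re_pos (by rw [Complex.ofReal_re]; linarith) (by simp [hτ0, hη0])
        (by simp), ← Complex.ofReal_neg (d / 2 - s), ← Complex.ofReal_cpow (by linarith)]
      simp only [r, hmax, hf, testToSchwartz_apply]
      push_cast
      congr 1
      ring
  have h3 := tendsto_nhds_unique (h1.congr' (by
    filter_upwards [hpos] with ε hε
    exact integral_schwinger_eq_limit q hs' f hε)) h2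
  have hη0 : η ≠ 0 := by rintro rfl; simp at hηη
  have hrc : Continuous r := φ.continuous.mul
    (((continuous_const.mul hcont).div_const _ |>.max continuous_const).rpow_const fun x ↦
      Or.inl (lt_of_lt_of_le (by norm_num) (le_max_right _ _)).ne')
  have hr0 : ∀ x, 0 ≤ r x := fun x ↦ mul_nonneg (hφ0 x) (Real.rpow_nonneg
    (le_trans (by norm_num) (le_max_right _ _)) _)
  have hri : 0 < ∫ x, r x := by
    refine integral_pos_of_integrable_nonneg_nonzero (x := x₀) hrc
      (hrc.integrable_of_hasCompactSupport φ.hasCompactSupport.mul_right) hr0 ?_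
    simp only [r, hφ1, one_mul]
    exact (Real.rpow_pos_of_pos (lt_of_lt_of_le (by norm_num) (le_max_right _ _)) _).ne'
  rw [integral_mul_const, integral_complex_ofReal] at h3
  refine mul_ne_zero (Complex.Gamma_ne_zero_of_re_pos (by simpa using hb))
    (mul_ne_zero (by exact_mod_cast hri.ne') ?_) h3.symm
  rw [Complex.cpow_ne_zero_iff]
  left
  simp [hτ0, hη0]

/-! ### Scaling of the boundary values -/

theorem tendsto_rpow_smul_zero {J : ℝ → ℂ} {κ η : ℝ} {c : ℂ} (hη : 0 < η)
    (h : Tendsto (fun l : ℝ ↦ l ^ κ • J l) (𝓝[>] 0) (𝓝 c)) :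
    Tendsto (fun l : ℝ ↦ l ^ (κ + η) • J l) (𝓝[>] 0) (𝓝 0) := by
  have h0 : Tendsto (fun l : ℝ ↦ l ^ η) (𝓝[>] 0) (𝓝 0) := by
    have := (Real.continuousAt_rpow_const 0 η (Or.inr hη.le)).tendsto.mono_left
      (nhdsWithin_le_nhds (s := Set.Ioi 0))
    rwa [Real.zero_rpow hη.ne'] at this
  have h2 := h0.smul h
  rw [zero_smul] at h2
  refine h2.congr' ?_
  filter_upwards [self_mem_nhdsWithin] with l hl
  rw [smul_smul, ← Real.rpow_add hl, add_comm]

/-- One test function with a nonzero limit at the exponent κ excludes every a < κ: convergence to 0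
at a would force the limit 0 at κ. -/
theorem scalingDegree_eq {E : Type*} [NormedAddCommGroup E] [NormedSpace ℝ E]
    {T : 𝓓'((⊤ : Opens E), ℂ)} {κ : ℝ}
    (hup : ∀ (φ : 𝓓((⊤ : Opens E), ℝ)) (η : ℝ), 0 < η →
      Tendsto (fun l : ℝ ↦ l ^ (κ + η) • dilation T l φ) (𝓝[>] 0) (𝓝 0))
    (hlow : ∃ (φ : 𝓓((⊤ : Opens E), ℝ)) (c : ℂ), c ≠ 0 ∧
      Tendsto (fun l : ℝ ↦ l ^ κ • dilation T l φ) (𝓝[>] 0) (𝓝 c)) :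
    scalingDegree T = (κ : EReal) := by
  refine le_antisymm ?_ ?_
  · refine EReal.le_of_forall_lt_iff_le.1 fun z hz ↦ sInf_le ⟨z, fun φ ↦ ?_, rfl⟩
    have hz' : κ < z := by exact_mod_cast hz
    have h := hup φ (z - κ) (by linarith)
    rwa [add_sub_cancel] at h
  · refine le_sInf ?_
    rintro _ ⟨a, ha, rfl⟩
    obtain ⟨φ, c, hc, h⟩ := hlow
    rw [EReal.coe_le_coe_iff]
    by_contra! hlt
    have h2 := tendsto_rpow_smul_zero (η := κ - a) (by linarith) (ha φ)
    rw [add_sub_cancel] at h2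
    exact hc (tendsto_nhds_unique h h2)

/-- The test function `s φ + ½ x · ∇φ`. -/
theorem exists_testToSchwartz_eq_eulerShift (s : ℝ)
    (φ : 𝓓((⊤ : Opens (EuclideanSpace ℝ (Fin d))), ℝ)) :
    ∃ ψ : 𝓓((⊤ : Opens (EuclideanSpace ℝ (Fin d))), ℝ),
      testToSchwartz ψ = eulerShift s (testToSchwartz φ) := by
  have hc : ContDiff ℝ (⊤ : ℕ∞) φ := φ.contDiff
  have hf : ContDiff ℝ (⊤ : ℕ∞) (fderiv ℝ φ) := hc.fderiv_right (by simp)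
  refine ⟨⟨fun x ↦ s * φ x + 1 / 2 * fderiv ℝ φ x x,
    (contDiff_const.mul hc).add (contDiff_const.mul (hf.clm_apply contDiff_id)),
    φ.hasCompactSupport.mono' fun x hx ↦ ?_, fun _ _ ↦ trivial⟩, ?_⟩
  · by_contra hxs
    apply hx
    have h1 : φ x = 0 := image_eq_zero_of_notMem_tsupport hxs
    have h2 : fderiv ℝ φ x = 0 := image_eq_zero_of_notMem_tsupport
      fun h ↦ hxs (tsupport_fderiv_subset ℝ h)
    simp [h1, h2]
  · ext x
    have h1 : HasFDerivAt φ (fderiv ℝ φ x) x :=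
      (hc.differentiable (by simp)).differentiableAt.hasFDerivAt
    have h2 : HasFDerivAt (testToSchwartz φ : EuclideanSpace ℝ (Fin d) → ℂ)
        (Complex.ofRealCLM ∘L fderiv ℝ φ x) x := Complex.ofRealCLM.hasFDerivAt.comp x h1
    rw [eulerShift_apply, testToSchwartz_apply, add_apply, smul_apply,
      smul_apply, euler_apply, h2.fderiv]
    change ((s * φ x + 1 / 2 * fderiv ℝ φ x x : ℝ) : ℂ) = _
    simp

theorem exists_integral_testToSchwartz_ne_zero :
    ∃ φ : 𝓓((⊤ : Opens (EuclideanSpace ℝ (Fin d))), ℝ), ∫ x, testToSchwartz φ x ≠ 0 := by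
  obtain ⟨φ, hφ0, hφ1, -⟩ := exists_bump (univ_mem : Set.univ ∈ 𝓝 (0 : EuclideanSpace ℝ (Fin d)))
  refine ⟨φ, ?_⟩
  have h : 0 < ∫ x, φ x := integral_pos_of_integrable_nonneg_nonzero (x := 0) φ.continuous
    (φ.continuous.integrable_of_hasCompactSupport φ.hasCompactSupport) hφ0 (by simp [hφ1])
  simp only [testToSchwartz_apply]
  rw [integral_complex_ofReal]
  exact_mod_cast h.ne'

/-- `L f` is the boundary value at the rate `i y` of the Schwinger integral of index `s`. -/
def IsSchwingerLimit (q : ℕ) (τ s y : ℝ) (L : 𝓢(EuclideanSpace ℝ (Fin d), ℂ) → ℂ) : Prop :=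
  ∀ f, Tendsto (fun ε : ℝ ↦ ∫ t in Set.Ioi 0, schwinger q τ s f t *
    Complex.exp (-(((ε : ℂ) + Complex.I * (y : ℂ)) * t))) (𝓝[>] 0) (𝓝 (L f))

/-- At y = 0 absolute convergence is available because s < d/2; at y ≠ 0 oscillation replaces it for
every s. The majorant N serves for continuity. -/
theorem exists_isSchwingerLimit (q : ℕ) {τ : ℝ} (hτ : τ * τ = 1) {s y : ℝ} (hs : 0 < s)
    (hy : y = 0 → s < d / 2) :
    ∃ (L : 𝓢(EuclideanSpace ℝ (Fin d), ℂ) → ℂ) (N : 𝓢(EuclideanSpace ℝ (Fin d), ℂ) → ℝ),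
      IsSchwingerLimit q τ s y L ∧ Continuous N ∧ N 0 = 0 ∧ ∀ f, ‖L f‖ ≤ N f := by
  by_cases h0 : y = 0
  · obtain ⟨C, hC⟩ := exists_norm_integral_schwinger_le (d := d) q hτ hs (hy h0)
    refine ⟨fun f ↦ ∫ t in Set.Ioi 0, schwinger q τ s f t *
      Complex.exp (-((Complex.I * (y : ℂ)) * t)), fun f ↦ C * size q τ f, fun f ↦ ?_,
      (continuous_size q τ).const_mul C, by simp [size_zero], fun f ↦ hC f _ (by simp)⟩
    refine tendsto_integral_schwinger q hτ hs (hy h0) f ?_ (tendsto_rate y)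
    filter_upwards [self_mem_nhdsWithin] with ε hε
    rw [re_add_I_mul]
    exact le_of_lt hε
  · obtain ⟨n, hn⟩ := exists_nat_ge s
    obtain ⟨L, N, hL, hN, hN0, hLN, -⟩ := exists_schwinger_limit (d := d) q hτ h0 n s hs (by
      have : (0 : ℝ) ≤ d / 2 := by positivity
      linarith)
    exact ⟨L, N, hL, hN, hN0, hLN⟩

/-- After rescaling the rate is iyl² → 0: the mass disappears at short distance. -/
theorem IsSchwingerLimit.tendsto_of_lt {q : ℕ} {τ s y : ℝ}
    {L : 𝓢(EuclideanSpace ℝ (Fin d), ℂ) → ℂ} (hL : IsSchwingerLimit q τ s y L)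
    (hτ : τ * τ = 1) (hs : 0 < s) (hs' : s < d / 2) (f : 𝓢(EuclideanSpace ℝ (Fin d), ℂ)) :
    Tendsto (fun l : ℝ ↦ l ^ (d - 2 * s : ℝ) • L (dilate l f)) (𝓝[>] 0)
      (𝓝 (∫ t in Set.Ioi 0, schwinger q τ s f t)) := by
  have hLf : ∀ f, L f = ∫ t in Set.Ioi 0, schwinger q τ s f t *
      Complex.exp (-((Complex.I * (y : ℂ)) * t)) := fun f ↦ by
    refine tendsto_nhds_unique (hL f)
      (tendsto_integral_schwinger q hτ hs hs' f ?_ (tendsto_rate y))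
    filter_upwards [self_mem_nhdsWithin] with ε hε
    rw [re_add_I_mul]
    exact le_of_lt hε
  have hz : Tendsto (fun l : ℝ ↦ Complex.I * (y : ℂ) * ((l ^ 2 : ℝ) : ℂ)) (𝓝[>] 0) (𝓝 0) := by
    have : Continuous fun l : ℝ ↦ Complex.I * (y : ℂ) * ((l ^ 2 : ℝ) : ℂ) := by fun_prop
    have h := (this.tendsto 0).mono_left (nhdsWithin_le_nhds (s := Set.Ioi 0))
    simpa using h
  have h := tendsto_integral_schwinger q hτ hs hs' f (l := 𝓝[>] (0 : ℝ))
    (.of_forall fun l ↦ by rw [Complex.re_mul_ofReal]; simp) hz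
  simp only [zero_mul, neg_zero, Complex.exp_zero, mul_one] at h
  refine h.congr' ?_
  filter_upwards [self_mem_nhdsWithin] with l hl
  have hl' : 0 < l := hl
  rw [hLf, integral_schwinger_dilate q τ s hl', Complex.real_smul, ← mul_assoc,
    ← Complex.ofReal_mul, ← Real.rpow_add hl']
  simp

theorem IsSchwingerLimit.tendsto_of_gt {q : ℕ} {τ s y : ℝ}
    {L : 𝓢(EuclideanSpace ℝ (Fin d), ℂ) → ℂ} (hL : IsSchwingerLimit q τ s y L)
    (hτ : τ * τ = 1) (hy : y ≠ 0) (hs : d / 2 < s) :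
    ∃ c : ℂ, c ≠ 0 ∧ ∀ f, Tendsto (fun l ↦ L (dilate l f)) (𝓝[>] 0) (𝓝 (c * ∫ x, f x)) := by
  have hd : (0 : ℝ) ≤ d / 2 := by positivity
  obtain ⟨n, hn⟩ := exists_nat_ge s
  obtain ⟨L', -, hL', -, -, -, h⟩ := exists_schwinger_limit (d := d) q hτ hy n s (by linarith)
    (by linarith)
  have : L = L' := funext fun f ↦ tendsto_nhds_unique (hL f) (hL' f)
  rw [this]
  exact h hs

/-- At the critical index a loss l^(-2θ) with θ > 0 arbitrarily small suffices as an upper bound,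
and any factor l^η absorbs it. -/
theorem IsSchwingerLimit.tendsto_zero_of_eq {q : ℕ} {τ s y : ℝ}
    {L : 𝓢(EuclideanSpace ℝ (Fin d), ℂ) → ℂ} (hL : IsSchwingerLimit q τ s y L)
    (hτ : τ * τ = 1) (hy : y ≠ 0) (hs : 0 < s) (hsd : s = d / 2) {η : ℝ} (hη : 0 < η)
    (f : 𝓢(EuclideanSpace ℝ (Fin d), ℂ)) :
    Tendsto (fun l : ℝ ↦ l ^ η • L (dilate l f)) (𝓝[>] 0) (𝓝 0) := by
  have hLf : ∀ f, L f = schwingerReg q τ s f (Complex.I * y) := fun f ↦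
    tendsto_nhds_unique (hL f) (tendsto_schwingerReg q hτ hs (by linarith) f hy)
  -- θ ≤ η/4 leaves the factor l^(η/2) over; θ ≤ d/2 is the range of the interpolated bound, and d/2
  -- = s is positive.
  have hθ : 0 < min (η / 4) (d / 2) := lt_min (by linarith) (by linarith)
  obtain ⟨C, hC⟩ := norm_schwingerReg_dilate_le (d := d) q hτ (s := s) (θ := min (η / 4) (d / 2))
    (by linarith) hθ.le (min_le_right _ _) (by linarith) y
  have hη2 : 2 * min (η / 4) (d / 2) ≤ η / 2 := by
    linarith [min_le_left (η / 4) ((d : ℝ) / 2)]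
  have h0 : Tendsto (fun l : ℝ ↦ l ^ (η / 2) * (|C| * size q τ f)) (𝓝[>] 0) (𝓝 0) := by
    have := (Real.continuousAt_rpow_const 0 (η / 2) (Or.inr (by linarith))).tendsto.mono_left
      (nhdsWithin_le_nhds (s := Set.Ioi 0))
    rw [Real.zero_rpow (by linarith)] at this
    simpa using this.mul_const (|C| * size q τ f)
  refine squeeze_zero_norm' ?_ h0
  have hone : ∀ᶠ l : ℝ in 𝓝[>] 0, l ≤ 1 :=
    mem_nhdsWithin_of_mem_nhds (Iic_mem_nhds (zero_lt_one (α := ℝ)))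
  filter_upwards [self_mem_nhdsWithin, hone] with l hl hl1
  have hl' : 0 < l := hl
  have hS := size_nonneg q τ f
  rw [norm_smul, hLf, Real.norm_of_nonneg (by positivity)]
  calc l ^ η * ‖schwingerReg q τ s (dilate l f) (Complex.I * y)‖
      ≤ l ^ η * (|C| * l ^ (-(η / 2)) * size q τ f) := by
        refine mul_le_mul_of_nonneg_left ((hC l hl' hl1 f).trans ?_) (by positivity)
        refine mul_le_mul_of_nonneg_right ?_ hS
        refine mul_le_mul (le_abs_self C) ?_ (by positivity) (abs_nonneg C)
        exact Real.rpow_le_rpow_of_exponent_ge hl' hl1 (by linarith)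
    _ = l ^ (η / 2) * (|C| * size q τ f) := by
        have : l ^ η * l ^ (-(η / 2)) = l ^ (η / 2) := by
          rw [← Real.rpow_add hl']; congr 1; ring
        rw [← this]; ring

/-- The behaviour of the boundary value under dilations, for `s ≥ d/2`. -/
theorem IsSchwingerLimit.scaling_of_ge {q : ℕ} {τ s y : ℝ}
    {L : 𝓢(EuclideanSpace ℝ (Fin d), ℂ) → ℂ} (hL : IsSchwingerLimit q τ s y L)
    (hτ : τ * τ = 1) (hy : y ≠ 0) (hs : 0 < s) (hsd : d / 2 ≤ s) :
    (∀ (f : 𝓢(EuclideanSpace ℝ (Fin d), ℂ)) (η : ℝ), 0 < η →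
      Tendsto (fun l : ℝ ↦ l ^ η • L (dilate l f)) (𝓝[>] 0) (𝓝 0)) ∧
    ∃ (φ : 𝓓((⊤ : Opens (EuclideanSpace ℝ (Fin d))), ℝ)) (c : ℂ), c ≠ 0 ∧
      Tendsto (fun l : ℝ ↦ L (dilate l (testToSchwartz φ))) (𝓝[>] 0) (𝓝 c) := by
  obtain ⟨φ, hφ⟩ := exists_integral_testToSchwartz_ne_zero (d := d)
  rcases hsd.eq_or_lt with h | h
  · refine ⟨fun f η hη ↦ hL.tendsto_zero_of_eq hτ hy hs h.symm hη f, ?_⟩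
    -- At s = d/2 take ψ = E_s φ, whose integral vanishes. The recursion gives L(E_s φ) = iy L'(φ)
    -- with L' of index s + 1 > d/2, and L' has a nonzero limit under dilations of φ.
    obtain ⟨ψ, hψ⟩ := exists_testToSchwartz_eq_eulerShift s φ
    obtain ⟨L', -, hL', -⟩ := exists_isSchwingerLimit (d := d) q hτ (s := s + 1) (y := y)
      (by linarith) (fun h ↦ absurd h hy)
    obtain ⟨c, hc, hcL⟩ := hL'.tendsto_of_gt hτ hy (by linarith)
    have hy0 : Complex.I * (y : ℂ) ≠ 0 := by simp [hy]
    have hrec : ∀ f, L (eulerShift s f) = L' f * (Complex.I * y) := fun f ↦ by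
      refine tendsto_nhds_unique (hL (eulerShift s f)) (((hL' f).mul (tendsto_rate y)).congr' ?_)
      filter_upwards [self_mem_nhdsWithin] with ε hε
      have hε' : 0 < ((ε : ℂ) + Complex.I * (y : ℂ)).re := by rw [re_add_I_mul]; exact hε
      rw [integral_schwinger_add_one q hτ hs f hε', div_mul_cancel₀]
      intro h0
      rw [h0] at hε'
      simp at hε'
    refine ⟨ψ, _, mul_ne_zero (mul_ne_zero hc hφ) hy0,
      ((hcL (testToSchwartz φ)).mul_const (Complex.I * (y : ℂ))).congr' ?_⟩
    filter_upwards [self_mem_nhdsWithin] with l hl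
    rw [← hrec, hψ, eulerShift_dilate s (ne_of_gt hl)]
  · obtain ⟨c, hc, hcL⟩ := hL.tendsto_of_gt hτ hy h
    refine ⟨fun f η hη ↦ ?_, φ, _, mul_ne_zero hc hφ, hcL _⟩
    have h1 := tendsto_rpow_smul_zero (κ := 0) hη (J := fun l ↦ L (dilate l f))
      (by simpa using hcL f)
    simpa using h1

/-! ### Existence of the boundary value -/

/-- Linearity passes to the pointwise limit, and the majorant N gives continuity at 0, hence
everywhere. -/
theorem exists_tendsto_tempered {G : ℝ → 𝓢'(EuclideanSpace ℝ (Fin d), ℂ)}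
    {ℓ : 𝓢(EuclideanSpace ℝ (Fin d), ℂ) → ℂ} {N : 𝓢(EuclideanSpace ℝ (Fin d), ℂ) → ℝ}
    (h : ∀ f, Tendsto (fun ε ↦ G ε f) (𝓝[>] 0) (𝓝 (ℓ f))) (hN : Continuous N) (hN0 : N 0 = 0)
    (hb : ∀ f, ‖ℓ f‖ ≤ N f) :
    ∃ T : 𝓢'(EuclideanSpace ℝ (Fin d), ℂ), Tendsto G (𝓝[>] 0) (𝓝 T) := by
  let A : 𝓢(EuclideanSpace ℝ (Fin d), ℂ) →ₗ[ℂ] ℂ :=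
    linearMapOfTendsto ℓ (fun ε ↦ (G ε).toLinearMap) (tendsto_pi_nhds.2 h)
  have hA : Continuous A := by
    refine continuous_of_continuousAt_zero A ?_
    rw [ContinuousAt, map_zero]
    have hN' := hN.tendsto 0
    rw [hN0] at hN'
    exact squeeze_zero_norm hb hN'
  let T : 𝓢'(EuclideanSpace ℝ (Fin d), ℂ) := ⟨A, hA⟩
  exact ⟨T, PointwiseConvergenceCLM.tendsto_iff_forall_tendsto.2 h⟩

/-- A right inverse of `testFourier`. -/
theorem exists_testFourier_rightInverse (d q : ℕ) :
    ∃ R : 𝓢(EuclideanSpace ℝ (Fin d), ℂ) →L[ℂ] 𝓢(EuclideanSpace ℝ (Fin d), ℂ),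
      ∀ g, testFourier d q (R g) = g := by
  refine ⟨(((2 * Real.pi) ^ d : ℝ) : ℂ) • (FourierTransform.fourierInvCLM ℂ
    𝓢(EuclideanSpace ℝ (Fin d), ℂ) ∘L
    SchwartzMap.compCLMOfContinuousLinearEquiv ℂ (momentumEquiv d q).symm), fun g ↦ ?_⟩
  ext p
  simp [testFourier]

theorem tendsto_ofBounded_testFourier (q : ℕ) {τ σ : ℝ} (hτ : τ * τ = 1) (hσ : σ = -τ)
    {μ : ℝ} (hμ : 0 < μ) (m : ℝ) {L : 𝓢(EuclideanSpace ℝ (Fin d), ℂ) → ℂ}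
    (hL : IsSchwingerLimit q τ (μ / 2) (τ * m ^ 2) L) (f : 𝓢(EuclideanSpace ℝ (Fin d), ℂ)) :
    Tendsto (fun ε : ℝ ↦ ofBounded (symbol q μ m (σ * ε)) (testFourier d q f)) (𝓝[>] 0)
      (𝓝 (schwingerConst d q τ (μ / 2) * L f)) := by
  have hτ0 : τ ≠ 0 := by rintro rfl; simp at hτ
  refine ((hL f).const_mul _).congr' ?_
  filter_upwards [self_mem_nhdsWithin] with ε hε
  have hε' : 0 < ε := hε
  rw [ofBounded_apply (memLp_symbol q hμ m (by
    rw [hσ]; exact mul_ne_zero (neg_ne_zero.2 hτ0) hε'.ne')),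
    integral_testFourier_mul_symbol q hτ hσ hμ m hε']

/-- The Schwinger formula controls the symbols on Schwartz functions of the form `testFourier d q
f`; by the right inverse R these are all of them. Existence of a limit is what makes `limUnder` the
limit and not a default value. -/
theorem tendsto_boundaryValue (q : ℕ) {τ σ : ℝ} (hτ : τ * τ = 1) (hσ : σ = -τ)
    {μ : ℝ} (hμ : 0 < μ) {m : ℝ} (hm0 : m = 0 → μ < d) :
    Tendsto (fun ε : ℝ ↦ ofBounded (symbol q μ m (σ * ε))) (𝓝[>] 0)
        (𝓝 (boundaryValue d q σ μ m)) := by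
  have hτ0 : τ ≠ 0 := by rintro rfl; simp at hτ
  obtain ⟨L, N, hL, hN, hN0, hLN⟩ := exists_isSchwingerLimit (d := d) q hτ (s := μ / 2)
    (y := τ * m ^ 2) (by positivity) (fun h ↦ by
      have : m = 0 := by simpa [hτ0] using h
      linarith [hm0 this])
  obtain ⟨R, hR⟩ := exists_testFourier_rightInverse d q
  refine tendsto_nhds_limUnder (exists_tendsto_tempered
    (ℓ := fun g ↦ schwingerConst d q τ (μ / 2) * L (R g))
    (N := fun g ↦ ‖schwingerConst d q τ (μ / 2)‖ * N (R g)) (fun g ↦ ?_)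
    ((hN.comp R.continuous).const_mul _) (by simp [hN0]) fun g ↦ ?_)
  · have h := tendsto_ofBounded_testFourier q hτ hσ hμ m hL (R g)
    rwa [hR] at h
  · rw [norm_mul]
    exact mul_le_mul_of_nonneg_left (hLN _) (norm_nonneg _)

theorem boundaryValue_testFourier (q : ℕ) {τ σ : ℝ} (hτ : τ * τ = 1) (hσ : σ = -τ)
    {μ : ℝ} (hμ : 0 < μ) {m : ℝ} (hm0 : m = 0 → μ < d)
    {L : 𝓢(EuclideanSpace ℝ (Fin d), ℂ) → ℂ}
    (hL : IsSchwingerLimit q τ (μ / 2) (τ * m ^ 2) L) (f : 𝓢(EuclideanSpace ℝ (Fin d), ℂ)) :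
    boundaryValue d q σ μ m (testFourier d q f) = schwingerConst d q τ (μ / 2) * L f := by
  have h := tendsto_boundaryValue q hτ hσ hμ hm0
  rw [PointwiseConvergenceCLM.tendsto_iff_forall_tendsto] at h
  exact tendsto_nhds_unique (h _) (tendsto_ofBounded_testFourier q hτ hσ hμ m hL f)

theorem dilation_toDistribution (T : 𝓢'(EuclideanSpace ℝ (Fin d), ℂ)) {l : ℝ} (hl : 0 < l)
    (φ : 𝓓((⊤ : Opens (EuclideanSpace ℝ (Fin d))), ℝ)) :
    dilation (toDistribution T) l φ = T (dilate l (testToSchwartz φ)) := by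
  have h : dilate l (testToSchwartz φ) =
      (((l ^ d)⁻¹ : ℝ) : ℂ) • testToSchwartz (testDilation l hl φ) := by
    ext x
    rw [dilate_apply hl.ne']
    rfl
  rw [dilation_apply _ hl, h, map_smul, finrank_euclideanSpace, Fintype.card_fin,
    Complex.real_smul]
  rfl

theorem scalingDegree_boundaryValue (q : ℕ) {τ σ : ℝ} (hτ : τ * τ = 1) (hσ : σ = -τ)
    {μ : ℝ} (hμ : 0 < μ) {m : ℝ} (hm0 : m = 0 → μ < d) :
    (μ < d → scalingDegree (toDistribution (pseudoFourierInv q (boundaryValue d q σ μ m))) =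
      ((d - μ : ℝ) : EReal)) ∧
    (d ≤ μ → scalingDegree (toDistribution (pseudoFourierInv q (boundaryValue d q σ μ m))) =
      ((0 : ℝ) : EReal)) := by
  have hτ0 : τ ≠ 0 := by rintro rfl; simp at hτ
  have hs : 0 < μ / 2 := by positivity
  obtain ⟨L, -, hL, -⟩ := exists_isSchwingerLimit (d := d) q hτ (s := μ / 2)
    (y := τ * m ^ 2) (by positivity) (fun h ↦ by
      have : m = 0 := by simpa [hτ0] using h
      linarith [hm0 this])
  have hK := schwingerConst_ne_zero (d := d) q hτ0 hs
  have key : ∀ (κ : ℝ) (φ : 𝓓((⊤ : Opens (EuclideanSpace ℝ (Fin d))), ℝ)) (c : ℂ),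
      Tendsto (fun l : ℝ ↦ l ^ κ • L (dilate l (testToSchwartz φ))) (𝓝[>] 0) (𝓝 c) →
      Tendsto (fun l : ℝ ↦ l ^ κ • dilation (toDistribution (pseudoFourierInv q
        (boundaryValue d q σ μ m))) l φ) (𝓝[>] 0) (𝓝 (schwingerConst d q τ (μ / 2) * c)) := by
    intro κ φ c h
    refine (h.const_mul _).congr' ?_
    filter_upwards [self_mem_nhdsWithin] with l hl
    rw [dilation_toDistribution _ hl, pseudoFourierInv_apply,
      boundaryValue_testFourier q hτ hσ hμ hm0 hL, mul_smul_comm]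
  refine ⟨fun hd ↦ ?_, fun hd ↦ ?_⟩
  · have hs' : μ / 2 < d / 2 := by linarith
    have hlim := hL.tendsto_of_lt hτ hs hs'
    rw [show (d : ℝ) - 2 * (μ / 2) = d - μ by ring] at hlim
    refine scalingDegree_eq (fun φ η hη ↦ ?_) ?_
    · simpa using key _ φ 0 (tendsto_rpow_smul_zero hη (hlim _))
    · obtain ⟨φ, hφ⟩ := exists_integral_schwinger_ne_zero q hτ hs hs'
      exact ⟨φ, _, mul_ne_zero hK hφ, key _ φ _ (hlim _)⟩
  -- For μ ≥ d the mass cannot vanish, so the rate y = τm² is nonzero.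
  · have hm : m ≠ 0 := fun h ↦ absurd (hm0 h) (not_lt.2 hd)
    obtain ⟨hup, φ, c, hc, hlow⟩ := hL.scaling_of_ge hτ (mul_ne_zero hτ0 (pow_ne_zero 2 hm)) hs
      (by linarith)
    refine scalingDegree_eq (fun φ η hη ↦ ?_) ⟨φ, _, mul_ne_zero hK hc, key 0 φ c ?_⟩
    · simpa using key (0 + η) φ 0 (by rw [zero_add]; exact hup _ η hη)
    · simpa using hlow

end BesselPotential

open BesselPotential
theorem mainTheorem5 (d q : ℕ) (hq : q ≤ d) (μ m : ℝ) (hμ : 0 < μ) (hm : 0 ≤ m)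
    (hm0 : m = 0 → μ < d) :
    (∀ σ : ℝ, σ = -1 ∨ σ = 1 →
      Tendsto (fun ε : ℝ ↦ ofBounded (symbol q μ m (σ * ε))) (𝓝[>] 0)
        (𝓝 (boundaryValue d q σ μ m))) ∧
    (μ ≤ d →
      scalingDegree (toDistribution (feynman d q μ m)) = ((d - μ : ℝ) : EReal) ∧
      scalingDegree (toDistribution (antiFeynman d q μ m)) = ((d - μ : ℝ) : EReal)) ∧
    (d ≤ μ →
      scalingDegree (toDistribution (feynman d q μ m)) = 0 ∧
      scalingDegree (toDistribution (antiFeynman d q μ m)) = 0) := by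
  -- The sign of iε is σ = -τ, so the Feynman case is τ = 1 and the anti-Feynman case τ = -1.
  have hF := scalingDegree_boundaryValue (d := d) q (τ := 1) (σ := -1) (by norm_num) rfl hμ hm0
  have hA := scalingDegree_boundaryValue (d := d) q (τ := -1) (σ := 1) (by norm_num) (by norm_num)
    hμ hm0
  refine ⟨?_, fun h ↦ ?_, fun h ↦ ⟨(hF.2 h).trans EReal.coe_zero, (hA.2 h).trans EReal.coe_zero⟩⟩
  · rintro σ (rfl | rfl)
    · exact tendsto_boundaryValue q (τ := 1) (by norm_num) rfl hμ hm0
    · exact tendsto_boundaryValue q (τ := -1) (by norm_num) (by norm_num) hμ hm0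
  -- At μ = d the value d - μ is 0 and comes from the case d ≤ μ.
  · rcases h.lt_or_eq with h | h
    · exact ⟨hF.1 h, hA.1 h⟩
    · rw [show (d : ℝ) - μ = 0 by linarith]
      exact ⟨hF.2 h.ge, hA.2 h.ge⟩
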